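/- Let $g(t)=2^{1/4}e^{-\pi t^2}$ and, for $k\ge 0$, let $$h_k(x)=\frac{(-1)^k}{\sqrt{2^{2k-1/2}\,\pi^k\,k!}}\;e^{\pi x^2}\,\frac{d^k}{dx^k}e^{-2\pi x^2}$$ be the $L^2(\mathbb R)$-orthonormal Hermite functions. For a tempered distribution $y$ on $\mathbb R$ put $V_gy(u,v)=\langle y, M_vT_ug\rangle$, where $M_vT_ug(t)=e^{2\pi i vt}g(t-u)$ (for $f\in L^2(\mathbb R)$, $V_gf(u,v)=\int f\,\overline{M_vT_ug}$; for real $f$ both conventions give the same $|V_gf|$). Let $\xi$ be real Gaussian white noise on $\mathbb R$, i.e. a random tempered distribution such that, for every real Schwartz function $\phi$, $\langle\xi,\phi\rangle$ is almost surely real and $\mathbb E\,e^{i\langle\xi,\phi\rangle}=e^{-\|\phi\|_{L^2}^2/2}$. For $L>0$ and an observation $y$ let $$\Lambda(\gamma)=\{(u,v)\in\mathbb R^2:\ \max(|u|,|v|)\le L,\ |V_gy(u,v)|\ge\gamma\},\qquad \psi_\theta=\mathbf 1\{\Lambda(\theta)\neq\emptyset\},$$ and for an integer $l\ge 1$ let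 $\mathfrak M(l)=\min_{1\le k\le l}\max_{u,v\in\mathbb R}|V_gh_k(u,v)|$. There is a universal constant $K>0$ such that the following hold for every noise level $\sigma\in(0,\sqrt\pi]$ (the case $\sigma=1$ being standard white noise). (i) For all $L\ge\pi$ and $\tau>0$, $$\mathbb P\Big[\sup_{\max(|u|,|v|)\le L}|V_g(\sigma\xi)(u,v)|\le\sqrt2\,(14K+\tau)\sqrt{\log L}\Big]\ \ge\ 1-4\exp\Big(-\frac{\tau^2}{2\pi}\log L\Big).$$ (ii) With this same $K$: let $k_0\ge 1$ be an integer, $L\ge\max\{\sqrt{k_0/\pi},\pi\}$, $\delta>0$, and $$\theta(\delta)=3\sqrt2\Big(14K\sqrt{\log L}+\sqrt{2\pi\log(4/\delta)}\Big)$$ (for $\delta>4$, where the last root is undefined, it is read as $0$). Let $\lambda\in\mathbb R$ satisfy $$|\lambda|\ \ge\ 5\sqrt2\;\mathfrak M(k_0)^{-1}\Big(14K\sqrt{\log L}+\sqrt{2\pi\log(4/\delta)}\Big).$$ Then $\psi_{\theta(\delta)}$ is a measurable test whose errors are both at most $\delta$: if $y=\sigma\xi$ (pure noise), then $\mathbb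 P[\psi_{\theta(\delta)}=1]\le\delta$; and for every integer $1\le k\le k_0$, if $y=\lambda h_k+\sigma\xi$, then $\mathbb P[\psi_{\theta(\delta)}=0]\le\delta$. -/

import Mathlib

open MeasureTheory
open scoped SchwartzMap ContDiff

namespace GaborDetection

/-! ### Schwartz functions of the form polynomial times Gaussian -/

theorem abs_pow_mul_exp_le (m : ℕ) (x : ℝ) :
    |x| ^ m * Real.exp (-(Real.pi * x ^ 2)) ≤ 1 + (m.factorial : ℝ) := by
  have h1 : (x ^ 2) ^ m / (m.factorial : ℝ) ≤ Real.exp (x ^ 2) :=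
    Real.pow_div_factorial_le_exp _ (sq_nonneg x) m
  have hf : (0 : ℝ) < m.factorial := by exact_mod_cast m.factorial_pos
  have h2 : (x ^ 2) ^ m ≤ m.factorial * Real.exp (x ^ 2) := by
    rw [div_le_iff₀ hf] at h1; linarith
  have h3 : |x| ^ m ≤ 1 + (x ^ 2) ^ m := by
    have h4 : (x ^ 2) ^ m = (|x| ^ m) ^ 2 := by
      rw [← sq_abs x, ← pow_mul, ← pow_mul, mul_comm]
    rw [h4]
    nlinarith [sq_nonneg (|x| ^ m - 1)]
  have h5 : Real.exp (-(Real.pi * x ^ 2)) ≤ Real.exp (-(x ^ 2)) := by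
    apply Real.exp_le_exp.mpr
    nlinarith [Real.pi_gt_three, sq_nonneg x]
  have h6 : Real.exp (-(x ^ 2)) ≤ 1 := by
    rw [Real.exp_le_one_iff]; nlinarith [sq_nonneg x]
  have h7 : Real.exp (x ^ 2) * Real.exp (-(x ^ 2)) = 1 := by
    rw [← Real.exp_add]; simp
  calc |x| ^ m * Real.exp (-(Real.pi * x ^ 2))
      ≤ (1 + m.factorial * Real.exp (x ^ 2)) * Real.exp (-(x ^ 2)) := by
        apply mul_le_mul (by linarith) h5 (Real.exp_pos _).le (by positivity)
    _ = Real.exp (-(x ^ 2)) + m.factorial * (Real.exp (x ^ 2) * Real.exp (-(x ^ 2))) := by ring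
    _ ≤ 1 + (m.factorial : ℝ) := by rw [h7]; linarith

theorem exists_poly_gauss_bound (p : Polynomial ℝ) :
    ∃ C : ℝ, ∀ x : ℝ, |p.eval x * Real.exp (-(Real.pi * x ^ 2))| ≤ C := by
  induction p using Polynomial.induction_on' with
  | add p q hp hq =>
    obtain ⟨C, hC⟩ := hp
    obtain ⟨D, hD⟩ := hq
    refine ⟨C + D, fun x => ?_⟩
    rw [Polynomial.eval_add, add_mul]
    exact (abs_add_le _ _).trans (add_le_add (hC x) (hD x))
  | monomial n a =>
    refine ⟨|a| * (1 + (n.factorial : ℝ)), fun x => ?_⟩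
    rw [Polynomial.eval_monomial, abs_mul, abs_mul, abs_pow, abs_of_pos (Real.exp_pos _), mul_assoc]
    exact mul_le_mul_of_nonneg_left (abs_pow_mul_exp_le n x) (abs_nonneg a)

theorem exists_poly_iteratedDeriv (c : ℝ) (p : Polynomial ℝ) (n : ℕ) :
    ∃ q : Polynomial ℝ, iteratedDeriv n (fun x : ℝ => p.eval x * Real.exp (-(c * x ^ 2))) =
      fun x : ℝ => q.eval x * Real.exp (-(c * x ^ 2)) := by
  induction n with
  | zero => exact ⟨p, by simp⟩
  | succ n ih =>
    obtain ⟨q, hq⟩ := ih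
    refine ⟨q.derivative - Polynomial.C (2 * c) * Polynomial.X * q, ?_⟩
    rw [iteratedDeriv_succ, hq]
    funext x
    have h1 : HasDerivAt (fun x : ℝ => Real.exp (-(c * x ^ 2)))
        (Real.exp (-(c * x ^ 2)) * (-(c * (2 * x)))) x := by
      have := ((((hasDerivAt_id x).pow 2).const_mul c).neg).exp
      simpa using this
    have h2 : HasDerivAt (fun x : ℝ => q.eval x * Real.exp (-(c * x ^ 2))) _ x :=
      (q.hasDerivAt x).mul h1
    rw [h2.deriv]
    simp only [Polynomial.eval_sub, Polynomial.eval_mul, Polynomial.eval_C, Polynomial.eval_X]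
    ring

/-- A real function of the form polynomial times `exp (-π x²)`, as a Schwartz function. -/
noncomputable def schwartzOfGauss (f : ℝ → ℝ)
    (hf : ∃ p : Polynomial ℝ, f = fun x => p.eval x * Real.exp (-(Real.pi * x ^ 2))) :
    𝓢(ℝ, ℂ) :=
  SchwartzMap.postcompCLM (𝕜 := ℝ) Complex.ofRealCLM
    { toFun := f
      smooth' := by
        obtain ⟨p, rfl⟩ := hf
        have hp : ContDiff ℝ ∞ (fun x : ℝ => p.eval x) := by
          simpa [Polynomial.aeval_def, Polynomial.eval₂_eq_eval_map] using
            p.contDiff_aeval (𝕜 := ℝ) ∞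
        exact hp.mul (by fun_prop)
      decay' := by
        obtain ⟨p, rfl⟩ := hf
        intro k n
        obtain ⟨q, hq⟩ := exists_poly_iteratedDeriv Real.pi p n
        obtain ⟨C, hC⟩ := exists_poly_gauss_bound (Polynomial.X ^ k * q)
        refine ⟨C, fun x => ?_⟩
        rw [norm_iteratedFDeriv_eq_norm_iteratedDeriv, hq, ← norm_pow, ← norm_mul,
          Real.norm_eq_abs]
        have := hC x
        rwa [Polynomial.eval_mul, Polynomial.eval_pow, Polynomial.eval_X, mul_assoc] at this }

@[simp]
theorem schwartzOfGauss_apply (f : ℝ → ℝ)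
    (hf : ∃ p : Polynomial ℝ, f = fun x => p.eval x * Real.exp (-(Real.pi * x ^ 2))) (x : ℝ) :
    schwartzOfGauss f hf x = (f x : ℂ) := rfl

/-! ### The Gaussian window and the Hermite functions -/

/-- The Gaussian window `g(t) = 2^{1/4} e^{-π t²}`. -/
noncomputable def gaussFun (t : ℝ) : ℝ :=
  (2 : ℝ) ^ (1 / 4 : ℝ) * Real.exp (-(Real.pi * t ^ 2))

theorem gaussFun_poly : ∃ p : Polynomial ℝ,
    gaussFun = fun x => p.eval x * Real.exp (-(Real.pi * x ^ 2)) :=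
  ⟨Polynomial.C ((2 : ℝ) ^ (1 / 4 : ℝ)), by funext x; simp [gaussFun]⟩

/-- The Gaussian window as a Schwartz function. -/
noncomputable def gaussWindow : 𝓢(ℝ, ℂ) := schwartzOfGauss gaussFun gaussFun_poly

/-- The `L²`-normalised Hermite functions
`h_k(x) = (-1)^k (2^{2k-1/2} π^k k!)^{-1/2} e^{π x²} (d/dx)^k e^{-2π x²}`. -/
noncomputable def hermiteFun (k : ℕ) (x : ℝ) : ℝ :=
  (-1) ^ k / √((2 : ℝ) ^ (2 * (k : ℝ) - 1 / 2) * Real.pi ^ k * (k.factorial : ℝ)) *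
    Real.exp (Real.pi * x ^ 2) *
    iteratedDeriv k (fun s : ℝ => Real.exp (-(2 * Real.pi * s ^ 2))) x

theorem hermiteFun_poly (k : ℕ) : ∃ p : Polynomial ℝ,
    hermiteFun k = fun x => p.eval x * Real.exp (-(Real.pi * x ^ 2)) := by
  obtain ⟨q, hq⟩ := exists_poly_iteratedDeriv (2 * Real.pi) 1 k
  simp only [Polynomial.eval_one, one_mul] at hq
  refine ⟨Polynomial.C ((-1) ^ k /
    √((2 : ℝ) ^ (2 * (k : ℝ) - 1 / 2) * Real.pi ^ k * (k.factorial : ℝ))) * q, ?_⟩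
  funext x
  have h : Real.exp (Real.pi * x ^ 2) * Real.exp (-(2 * Real.pi * x ^ 2)) =
      Real.exp (-(Real.pi * x ^ 2)) := by
    rw [← Real.exp_add]; congr 1; ring
  simp only [hermiteFun, hq, Polynomial.eval_mul, Polynomial.eval_C]
  rw [← h]
  ring

/-- The Hermite function `h_k` as a Schwartz function. -/
noncomputable def hermiteSchwartz (k : ℕ) : 𝓢(ℝ, ℂ) :=
  schwartzOfGauss (hermiteFun k) (hermiteFun_poly k)

/-! ### Time-frequency shifts and the short-time Fourier transform -/

theorem iteratedDeriv_modulation (v : ℝ) (n : ℕ) :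
    iteratedDeriv n (fun t : ℝ => Complex.exp (2 * Real.pi * Complex.I * v * t)) =
      fun t : ℝ => (2 * Real.pi * Complex.I * v) ^ n *
        Complex.exp (2 * Real.pi * Complex.I * v * t) := by
  induction n with
  | zero => simp
  | succ n ih =>
    rw [iteratedDeriv_succ, ih]
    funext t
    have h1 : HasDerivAt (fun t : ℝ => Complex.exp (2 * Real.pi * Complex.I * v * t))
        (Complex.exp (2 * Real.pi * Complex.I * v * t) * (2 * Real.pi * Complex.I * v)) t := by
      have h2 := ((Complex.ofRealCLM.hasDerivAt (x := t)).const_mul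
        (2 * Real.pi * Complex.I * (v : ℂ))).cexp
      simpa using h2
    rw [(h1.const_mul _).deriv]
    ring

theorem modulation_hasTemperateGrowth (v : ℝ) :
    (fun t : ℝ => Complex.exp (2 * Real.pi * Complex.I * v * t)).HasTemperateGrowth := by
  have hs : ContDiff ℝ ∞ (fun t : ℝ => (t : ℂ)) := Complex.ofRealCLM.contDiff
  refine ⟨(contDiff_const.mul hs).cexp, fun n => ⟨0, ‖(2 * Real.pi * Complex.I * (v : ℂ)) ^ n‖, fun t => ?_⟩⟩
  rw [norm_iteratedFDeriv_eq_norm_iteratedDeriv, iteratedDeriv_modulation, norm_mul]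
  have h : ‖Complex.exp (2 * Real.pi * Complex.I * v * t)‖ = 1 := by
    have h2 : (2 * Real.pi * Complex.I * v * t : ℂ) =
        ((2 * Real.pi * v * t : ℝ) : ℂ) * Complex.I := by push_cast; ring
    rw [h2, Complex.norm_exp_ofReal_mul_I]
  simp [h]

/-- The time-frequency shift `M_v T_u φ : t ↦ e^{2π i v t} φ(t - u)` of a Schwartz function. -/
noncomputable def tfShift (u v : ℝ) (φ : 𝓢(ℝ, ℂ)) : 𝓢(ℝ, ℂ) :=
  SchwartzMap.smulLeftCLM ℂ (fun t : ℝ => Complex.exp (2 * Real.pi * Complex.I * v * t))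
    (SchwartzMap.compSubConstCLM ℂ u φ)

@[simp]
theorem tfShift_apply (u v : ℝ) (φ : 𝓢(ℝ, ℂ)) (t : ℝ) :
    tfShift u v φ t = Complex.exp (2 * Real.pi * Complex.I * v * t) * φ (t - u) := by
  simp [tfShift, SchwartzMap.smulLeftCLM_apply_apply (modulation_hasTemperateGrowth v)]

/-- The short-time Fourier transform `V_φ f(u,v) = ∫ f(t) conj((M_v T_u φ)(t)) dt` of a
function `f` with window `φ`. -/
noncomputable def stftFun (φ : 𝓢(ℝ, ℂ)) (f : ℝ → ℂ) (u v : ℝ) : ℂ :=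
  ∫ t : ℝ, f t * (starRingEnd ℂ) (tfShift u v φ t)

/-- The short-time Fourier transform `V_φ T(u,v) = ⟨T, M_v T_u φ⟩` of a tempered distribution `T`
with window `φ`, where `⟨T, ψ⟩ = T(ψ)`. For a real distribution and a real window its modulus does
not depend on whether the pairing is taken to be linear or conjugate linear in `ψ`. -/
noncomputable def stft (φ : 𝓢(ℝ, ℂ)) (T : 𝓢'(ℝ, ℂ)) (u v : ℝ) : ℂ :=
  T (tfShift u v φ)

/-- `𝔐(l) = min_{1 ≤ k ≤ l} max_{u,v} |V_g h_k(u,v)|` (for `l ≥ 1`). -/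
noncomputable def minimaxHeight (l : ℕ) : ℝ :=
  sInf ((fun k : ℕ => ⨆ z : ℝ × ℝ, ‖stftFun gaussWindow (hermiteSchwartz k) z.1 z.2‖) ''
    Set.Icc 1 l)

/-! ### White noise -/

/-- The Borel σ-algebra on the space of tempered distributions. -/
noncomputable instance : MeasurableSpace 𝓢'(ℝ, ℂ) := borel _

instance : BorelSpace 𝓢'(ℝ, ℂ) := ⟨rfl⟩

/-- `μ` is the law of (real, standard) Gaussian white noise on the tempered distributions: for
every real-valued Schwartz function `φ` the variable `⟨ξ, φ⟩` is almost surely real and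
`E exp(i⟨ξ, φ⟩) = exp(-‖φ‖²_{L²} / 2)`. -/
structure IsWhiteNoise (μ : Measure 𝓢'(ℝ, ℂ)) : Prop where
  isProbabilityMeasure : IsProbabilityMeasure μ
  real : ∀ φ : 𝓢(ℝ, ℂ), (∀ t, (φ t).im = 0) → ∀ᵐ ξ ∂μ, (ξ φ).im = 0
  charFun : ∀ φ : 𝓢(ℝ, ℂ), (∀ t, (φ t).im = 0) →
    ∫ ξ, Complex.exp (Complex.I * ξ φ) ∂μ =
      Complex.exp (-((1 / 2 * ∫ t : ℝ, ‖φ t‖ ^ 2 : ℝ) : ℂ))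

/-! ### Observations, level sets and the test -/

/-- The pure noise observation `y = σ ξ` (null hypothesis). -/
noncomputable def noiseObs (σ : ℝ) (ξ : 𝓢'(ℝ, ℂ)) : 𝓢'(ℝ, ℂ) := (σ : ℂ) • ξ

/-- The observation `y = lam h_k + σ ξ` (alternative hypothesis). -/
noncomputable def signalObs (lam σ : ℝ) (k : ℕ) (ξ : 𝓢'(ℝ, ℂ)) : 𝓢'(ℝ, ℂ) :=
  (lam : ℂ) • SchwartzMap.toTemperedDistributionCLM ℝ ℂ volume (hermiteSchwartz k) +
    (σ : ℂ) • ξ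

/-- The spectrogram level set
`Λ(γ) = {(u,v) : max(|u|,|v|) ≤ L, |V_g y(u,v)| ≥ γ}` of an observation `y`. -/
def levelSet (L γ : ℝ) (y : 𝓢'(ℝ, ℂ)) : Set (ℝ × ℝ) :=
  {z | max |z.1| |z.2| ≤ L ∧ γ ≤ ‖stft gaussWindow y z.1 z.2‖}

open Classical in
/-- The test: `1` (reject the null hypothesis) if the observed level set is non-empty,
`0` (accept) otherwise. -/
noncomputable def testValue (S : Set (ℝ × ℝ)) : Fin 2 := if S.Nonempty then 1 else 0

/-- The quantity `14 K √(log L) + √(2π log(4/δ))`. -/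
noncomputable def baseLevel (K L δ : ℝ) : ℝ :=
  14 * K * √(Real.log L) + √(2 * Real.pi * Real.log (4 / δ))

/-- The threshold `θ(δ) = 3√2 (14 K √(log L) + √(2π log(4/δ)))`. -/
noncomputable def threshold (K L δ : ℝ) : ℝ := 3 * √2 * baseLevel K L δ

/-- `K` is an admissible constant in the uniform bound for the Gabor transform of noise of level
at most `√π`: for `L ≥ π` and `τ > 0`, with probability at least `1 - 4 exp(-τ² log L / (2π))`,
`sup |V_g (σ ξ)| ≤ √2 (14 K + τ) √(log L)` over the square `max(|u|,|v|) ≤ L`. -/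
def IsNoiseBound (K : ℝ) : Prop :=
  ∀ μ : Measure 𝓢'(ℝ, ℂ), IsWhiteNoise μ → ∀ σ : ℝ, 0 < σ → σ ≤ √Real.pi →
    ∀ L : ℝ, Real.pi ≤ L → ∀ τ : ℝ, 0 < τ →
      1 - 4 * Real.exp (-(τ ^ 2 / (2 * Real.pi) * Real.log L)) ≤
        μ.real {ξ | ∀ u v : ℝ, max |u| |v| ≤ L →
          ‖stft gaussWindow (noiseObs σ ξ) u v‖ ≤ √2 * (14 * K + τ) * √(Real.log L)}

/-- The level set test at threshold `θ`, observed on the square of size `L`, detects the signals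
`lam h_k`, `1 ≤ k ≤ k₀`, in noise `σ ξ` with error level `δ`: the test is a random variable under
both hypotheses and its Type I and (worst case) Type II errors are at most `δ`. -/
structure Detects (μ : Measure 𝓢'(ℝ, ℂ)) (σ L θ lam : ℝ) (k₀ : ℕ) (δ : ℝ) : Prop where
  measurable_null : Measurable fun ξ => testValue (levelSet L θ (noiseObs σ ξ))
  measurable_alt : ∀ k : ℕ, 1 ≤ k → k ≤ k₀ →
    Measurable fun ξ => testValue (levelSet L θ (signalObs lam σ k ξ))
  typeI : μ.real {ξ | testValue (levelSet L θ (noiseObs σ ξ)) = 1} ≤ δ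
  typeII : ∀ k : ℕ, 1 ≤ k → k ≤ k₀ →
    μ.real {ξ | testValue (levelSet L θ (signalObs lam σ k ξ)) = 0} ≤ δ

end GaborDetection

namespace GaborDetection

/-! ### Coherent states depend holomorphically on their parameter -/

/-- The coherent state `t ↦ e^{π (Re ζ)²} g_ζ(t)`, an entire function of its parameter `ζ`. -/
noncomputable def coherent (ζ : ℂ) : 𝓢(ℝ, ℂ) :=
  (Real.exp (Real.pi * ζ.re ^ 2) : ℂ) • tfShift ζ.re ζ.im gaussWindow

/-- The entire Gaussian `e^{-π s²}`. -/
noncomputable def cgauss (s : ℂ) : ℂ := Complex.exp (-(Real.pi * s ^ 2))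

theorem contDiff_cgauss {n : WithTop ℕ∞} : ContDiff ℂ n cgauss := by
  unfold cgauss; fun_prop

theorem coherent_apply (ζ : ℂ) (t : ℝ) :
    coherent ζ t = (((2 : ℝ) ^ (1 / 4 : ℝ) : ℝ) : ℂ) * Complex.exp (Real.pi * ζ ^ 2) *
      cgauss (t - ζ) := by
  simp only [coherent, smul_apply, tfShift_apply, gaussWindow, schwartzOfGauss_apply,
    gaussFun, cgauss, smul_eq_mul]
  push_cast
  have h : (ζ : ℂ) = ζ.re + ζ.im * Complex.I := (Complex.re_add_im ζ).symm
  have e : Complex.exp (Real.pi * (ζ.re : ℂ) ^ 2) * (Complex.exp (2 * Real.pi * Complex.I * ζ.im * t) *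
      Complex.exp (-(Real.pi * ((t : ℂ) - ζ.re) ^ 2))) =
      Complex.exp (Real.pi * ζ ^ 2) * Complex.exp (-(Real.pi * (t - ζ) ^ 2)) := by
    rw [← Complex.exp_add, ← Complex.exp_add, ← Complex.exp_add]
    congr 1
    conv_rhs => rw [h]
    ring
  linear_combination (((2 : ℝ) ^ (1 / 4 : ℝ) : ℝ) : ℂ) * e

theorem hasDerivAt_iteratedDeriv_cgauss (n : ℕ) (s : ℂ) :
    HasDerivAt (iteratedDeriv n cgauss) (iteratedDeriv (n + 1) cgauss s) s := by
  rw [iteratedDeriv_succ]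
  exact ((contDiff_cgauss (n := ⊤)).differentiable_iteratedDeriv n
    (WithTop.coe_lt_top _) s).hasDerivAt

theorem iteratedDeriv_coherent (ζ : ℂ) (n : ℕ) (t : ℝ) :
    iteratedDeriv n (coherent ζ) t =
      (((2 : ℝ) ^ (1 / 4 : ℝ) : ℝ) : ℂ) * Complex.exp (Real.pi * ζ ^ 2) *
        iteratedDeriv n cgauss (t - ζ) := by
  induction n generalizing t with
  | zero => simpa using coherent_apply ζ t
  | succ n ih =>
    rw [iteratedDeriv_succ, funext ih]
    have h1 : HasDerivAt (fun t : ℝ => (t : ℂ) - ζ) 1 t :=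
      (Complex.ofRealCLM.hasDerivAt (x := t)).sub_const ζ
    have h2 := ((hasDerivAt_iteratedDeriv_cgauss n ((t : ℂ) - ζ)).comp t h1).const_mul
      ((((2 : ℝ) ^ (1 / 4 : ℝ) : ℝ) : ℂ) * Complex.exp (Real.pi * ζ ^ 2))
    rw [mul_one] at h2
    exact h2.deriv

theorem iteratedDeriv_coherent_hasDerivAt (ζ : ℂ) (n : ℕ) (t : ℝ) :
    HasDerivAt (fun w => iteratedDeriv n (coherent w) t)
      (2 * Real.pi * ζ * iteratedDeriv n (coherent ζ) t -
        iteratedDeriv (n + 1) (coherent ζ) t) ζ := by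
  simp only [iteratedDeriv_coherent]
  have h1 : HasDerivAt (fun w : ℂ => (t : ℂ) - w) (-1) ζ := (hasDerivAt_id ζ).const_sub _
  have h2 := (hasDerivAt_iteratedDeriv_cgauss n ((t : ℂ) - ζ)).comp ζ h1
  have h3 : HasDerivAt (fun w : ℂ => Complex.exp (Real.pi * w ^ 2))
      (Complex.exp (Real.pi * ζ ^ 2) * (Real.pi * (2 * ζ))) ζ := by
    have := ((((hasDerivAt_id ζ).pow 2).const_mul (Real.pi : ℂ))).cexp
    simpa using this
  have h4 := (h3.const_mul (((2 : ℝ) ^ (1 / 4 : ℝ) : ℝ) : ℂ)).mul h2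
  refine h4.congr_deriv ?_
  simp only [Function.comp_apply]
  ring

theorem norm_cgauss_le {t R : ℝ} {ζ w : ℂ} (hζ : ‖ζ‖ ≤ R) (hw : ‖w - (t - ζ)‖ ≤ 1) :
    ‖cgauss w‖ ≤ Real.exp (2 * Real.pi * (R + 1) ^ 2) * Real.exp (-(Real.pi * t ^ 2 / 2)) := by
  rw [cgauss, Complex.norm_exp, ← Real.exp_add]
  apply Real.exp_le_exp.mpr
  have hd : ‖w - t‖ ≤ R + 1 := by
    calc ‖w - t‖ = ‖(w - (t - ζ)) - ζ‖ := by congr 1; ring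
      _ ≤ _ := (norm_sub_le _ _).trans (by linarith)
  have h1 : (w.re - t) ^ 2 + w.im ^ 2 ≤ (R + 1) ^ 2 := by
    have h2 : ‖w - t‖ ^ 2 ≤ (R + 1) ^ 2 := by gcongr
    rw [← Complex.normSq_eq_norm_sq, Complex.normSq_apply] at h2
    simp at h2
    nlinarith
  have h3 : (-(Real.pi * w ^ 2) : ℂ).re = Real.pi * (w.im ^ 2 - w.re ^ 2) := by
    simp [pow_two, Complex.mul_re]; ring
  rw [h3]
  have h4 : w.im ^ 2 - w.re ^ 2 ≤ 2 * (R + 1) ^ 2 - t ^ 2 / 2 := by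
    nlinarith [sq_nonneg (w.re - t / 2 * 2 + (w.re)), sq_nonneg w.im]
  nlinarith [Real.pi_pos, mul_le_mul_of_nonneg_left h4 Real.pi_pos.le]

theorem abs_pow_mul_exp_half_le (m : ℕ) (x : ℝ) :
    |x| ^ m * Real.exp (-(Real.pi * x ^ 2 / 2)) ≤ 1 + (1 + ((2 * m).factorial : ℝ)) := by
  have h := abs_pow_mul_exp_le (2 * m) x
  have h2 : |x| ^ (2 * m) * Real.exp (-(Real.pi * x ^ 2)) =
      (|x| ^ m * Real.exp (-(Real.pi * x ^ 2 / 2))) ^ 2 := by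
    rw [mul_pow, ← pow_mul, mul_comm m 2, ← Real.exp_nat_mul]
    congr 2; push_cast; ring
  nlinarith [sq_nonneg (|x| ^ m * Real.exp (-(Real.pi * x ^ 2 / 2)) - 1)]

theorem coherent_bound (k n : ℕ) (R : ℝ) : ∃ C : ℝ, 0 ≤ C ∧ ∀ ζ : ℂ, ‖ζ‖ ≤ R → ∀ t : ℝ,
    ‖(|t| ^ k : ℝ) * iteratedDeriv n (coherent ζ) t‖ ≤ C := by
  refine ⟨(2 : ℝ) ^ (1 / 4 : ℝ) * Real.exp (Real.pi * R ^ 2) * (n.factorial *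
    Real.exp (2 * Real.pi * (R + 1) ^ 2)) * (1 + (1 + ((2 * k).factorial : ℝ))), by positivity,
    fun ζ hζ t => ?_⟩
  have h1 : ‖iteratedDeriv n cgauss (t - ζ)‖ ≤ n.factorial *
      (Real.exp (2 * Real.pi * (R + 1) ^ 2) * Real.exp (-(Real.pi * t ^ 2 / 2))) / 1 ^ n := by
    apply Complex.norm_iteratedDeriv_le_of_forall_mem_sphere_norm_le n one_pos
    · exact (contDiff_cgauss (n := 1)).differentiable (by norm_num) |>.diffContOnCl
    · intro z hz
      exact norm_cgauss_le hζ (by simpa [dist_eq_norm] using hz.le)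
  rw [one_pow, div_one] at h1
  have h2 : ‖Complex.exp (Real.pi * ζ ^ 2)‖ ≤ Real.exp (Real.pi * R ^ 2) := by
    refine (Complex.norm_exp_le_exp_norm _).trans (Real.exp_le_exp.mpr ?_)
    rw [norm_mul, norm_pow, Complex.norm_real, Real.norm_of_nonneg Real.pi_pos.le]
    gcongr
  rw [iteratedDeriv_coherent, norm_mul, norm_mul, norm_mul, Complex.norm_real, Complex.norm_real,
    Real.norm_of_nonneg (by positivity), Real.norm_of_nonneg (by positivity)]
  calc |t| ^ k * ((2 : ℝ) ^ (1 / 4 : ℝ) * ‖Complex.exp (Real.pi * ζ ^ 2)‖ *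
        ‖iteratedDeriv n cgauss (t - ζ)‖)
      ≤ |t| ^ k * ((2 : ℝ) ^ (1 / 4 : ℝ) * Real.exp (Real.pi * R ^ 2) * (n.factorial *
      (Real.exp (2 * Real.pi * (R + 1) ^ 2) * Real.exp (-(Real.pi * t ^ 2 / 2))))) := by gcongr
    _ = (2 : ℝ) ^ (1 / 4 : ℝ) * Real.exp (Real.pi * R ^ 2) * (n.factorial *
        Real.exp (2 * Real.pi * (R + 1) ^ 2)) * (|t| ^ k * Real.exp (-(Real.pi * t ^ 2 / 2))) := by
        ring
    _ ≤ _ := by gcongr; exact abs_pow_mul_exp_half_le k t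

/-- Second order Taylor estimate for a bounded holomorphic function on a disc. -/
theorem norm_sub_sub_mul_deriv_le {f : ℂ → ℂ} {f' c z : ℂ} {C : ℝ} (hf : Differentiable ℂ f)
    (hc : HasDerivAt f f' c) (hC : ∀ w ∈ Metric.ball c 1, ‖f w‖ ≤ C) (hz : z ∈ Metric.ball c 1) :
    ‖f z - f c - (z - c) * f'‖ ≤ 4 * C * ‖z - c‖ ^ 2 := by
  have hC0 : 0 ≤ C := (norm_nonneg _).trans (hC c (Metric.mem_ball_self one_pos))
  have hmaps : Set.MapsTo f (Metric.ball c 1) (Metric.closedBall (f c) (2 * C)) := by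
    intro w hw
    rw [mem_closedBall_iff_norm]
    exact (norm_sub_le _ _).trans (by linarith [hC w hw, hC c (Metric.mem_ball_self one_pos)])
  have hf' : ‖f'‖ ≤ 2 * C := by
    rw [← hc.deriv]
    simpa using Complex.norm_deriv_le_div_of_mapsTo_ball hf.differentiableOn hmaps one_pos
  have h := Complex.dist_le_mul_div_pow_of_mapsTo_ball_of_isLittleO (n := 1) (R₁ := 1)
    (R₂ := 4 * C) (f := fun w => f w - (w - c) * f') (c := c) (z := z)
    (by fun_prop) ?_ ?_ hz
  · simpa [dist_eq_norm, sub_right_comm] using h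
  · intro w hw
    have h1 := hmaps hw
    have h2 : ‖w - c‖ < 1 := by simpa [dist_eq_norm] using hw
    rw [mem_closedBall_iff_norm] at h1 ⊢
    calc ‖f w - (w - c) * f' - (f c - (c - c) * f')‖ = ‖(f w - f c) - (w - c) * f'‖ := by
          congr 1; ring
      _ ≤ ‖f w - f c‖ + ‖w - c‖ * ‖f'‖ := (norm_sub_le _ _).trans_eq (by rw [norm_mul])
      _ ≤ 2 * C + 1 * (2 * C) := by gcongr
      _ = 4 * C := by ring
  · have h1 := hasDerivAt_iff_isLittleO.mp hc
    simp only [pow_one]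
    refine (h1.norm_right.congr_left fun w => ?_)
    simp [sub_right_comm]

/-- The derivative of `coherent` with respect to its parameter. -/
noncomputable def coherentDeriv (ζ : ℂ) : 𝓢(ℝ, ℂ) :=
  (2 * Real.pi * ζ) • coherent ζ - SchwartzMap.derivCLM ℂ ℂ (coherent ζ)

theorem iteratedDeriv_coherentDeriv (ζ : ℂ) (n : ℕ) (t : ℝ) :
    iteratedDeriv n (coherentDeriv ζ) t = 2 * Real.pi * ζ * iteratedDeriv n (coherent ζ) t -
        iteratedDeriv (n + 1) (coherent ζ) t := by
  have h : (coherentDeriv ζ : ℝ → ℂ) = (fun t => (2 * Real.pi * ζ) * coherent ζ t) -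
      deriv (coherent ζ) := by
    funext t; simp [coherentDeriv]
  have hs := (coherent ζ).smooth'
  have hd : ContDiff ℝ ∞ (deriv (coherent ζ)) := by
    have := (SchwartzMap.derivCLM ℂ ℂ (coherent ζ)).smooth'
    convert this using 1
    funext t
    exact (SchwartzMap.derivCLM_apply ℂ (coherent ζ) t).symm
  rw [h, iteratedDeriv_sub, iteratedDeriv_succ', iteratedDeriv_const_mul_field]
  · exact (contDiff_const.mul (hs.of_le (by exact_mod_cast le_top))).contDiffAt
  · exact (hd.of_le (by exact_mod_cast le_top)).contDiffAt

theorem tendsto_slope_coherent (ζ : ℂ) :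
    Filter.Tendsto (slope coherent ζ) (nhdsWithin ζ {ζ}ᶜ) (nhds (coherentDeriv ζ)) := by
  rw [(schwartz_withSeminorms ℂ ℝ ℂ).tendsto_nhds _ _]
  rintro ⟨k, n⟩ ε hε
  obtain ⟨C, hC0, hC⟩ := coherent_bound k n (‖ζ‖ + 1)
  have hmem : Metric.ball ζ (min 1 (ε / (4 * C + 1))) ∈ nhdsWithin ζ {ζ}ᶜ :=
    nhdsWithin_le_nhds (Metric.ball_mem_nhds _ (by positivity))
  filter_upwards [hmem, self_mem_nhdsWithin] with w hw hne
  have hne' : w - ζ ≠ 0 := sub_ne_zero.mpr hne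
  have hw' : ‖w - ζ‖ < min 1 (ε / (4 * C + 1)) := by simpa [dist_eq_norm] using hw
  have hle : SchwartzMap.seminorm ℂ k n (slope coherent ζ w - coherentDeriv ζ) ≤
      4 * C * ‖w - ζ‖ := by
    refine SchwartzMap.seminorm_le_bound' ℂ k n _ (by positivity) fun t => ?_
    have hs : ∀ φ : 𝓢(ℝ, ℂ), ContDiffAt ℝ n φ t := fun φ => (φ.smooth n).contDiffAt
    have e : iteratedDeriv n (slope coherent ζ w - coherentDeriv ζ) t =
        (w - ζ)⁻¹ * (iteratedDeriv n (coherent w) t - iteratedDeriv n (coherent ζ) t) -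
          iteratedDeriv n (coherentDeriv ζ) t := by
      have h1 : ((slope coherent ζ w - coherentDeriv ζ : 𝓢(ℝ, ℂ)) : ℝ → ℂ) =
          (fun t => (w - ζ)⁻¹ * ((coherent w : ℝ → ℂ) - (coherent ζ : ℝ → ℂ)) t) -
            (coherentDeriv ζ : ℝ → ℂ) := by
        funext t; simp [slope_def_module]
      have h2 : ContDiffAt ℝ n ((coherent w : ℝ → ℂ) - (coherent ζ : ℝ → ℂ)) t :=
        (hs _).sub (hs _)
      rw [h1, iteratedDeriv_sub (contDiffAt_const.mul h2) (hs _),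
        iteratedDeriv_const_mul_field, iteratedDeriv_sub (hs _) (hs _)]
    have hd : Differentiable ℂ fun w => ((|t| ^ k : ℝ) : ℂ) * iteratedDeriv n (coherent w) t :=
      fun w => (iteratedDeriv_coherent_hasDerivAt w n t).differentiableAt.const_mul _
    have h3 := norm_sub_sub_mul_deriv_le hd
      ((iteratedDeriv_coherent_hasDerivAt ζ n t).const_mul ((|t| ^ k : ℝ) : ℂ)) (C := C) (z := w)
      (fun z hz => hC z (by
        have : ‖z - ζ‖ < 1 := by simpa [dist_eq_norm] using hz
        have := norm_le_norm_add_norm_sub' z ζ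
        linarith) t)
      (by simpa [dist_eq_norm] using (lt_min_iff.mp hw').1)
    rw [e, iteratedDeriv_coherentDeriv]
    have h4 : (|t| ^ k : ℝ) * ((w - ζ)⁻¹ * (iteratedDeriv n (coherent w) t -
        iteratedDeriv n (coherent ζ) t) - (2 * Real.pi * ζ * iteratedDeriv n (coherent ζ) t -
        iteratedDeriv (n + 1) (coherent ζ) t)) = (w - ζ)⁻¹ *
        ((|t| ^ k : ℝ) * iteratedDeriv n (coherent w) t -
          (|t| ^ k : ℝ) * iteratedDeriv n (coherent ζ) t - (w - ζ) * ((|t| ^ k : ℝ) *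
          (2 * Real.pi * ζ * iteratedDeriv n (coherent ζ) t -
        iteratedDeriv (n + 1) (coherent ζ) t))) := by
      field_simp
    have h5 : |t| ^ k = ‖((|t| ^ k : ℝ) : ℂ)‖ := by
      rw [Complex.norm_real, Real.norm_of_nonneg (by positivity)]
    rw [h5, ← norm_mul, h4, norm_mul, norm_inv]
    have h6 : 0 < ‖w - ζ‖ := norm_pos_iff.mpr hne'
    calc _ ≤ ‖w - ζ‖⁻¹ * (4 * C * ‖w - ζ‖ ^ 2) := by gcongr
      _ = _ := by field_simp
  refine lt_of_le_of_lt hle ?_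
  have h7 := (lt_min_iff.mp hw').2
  rw [lt_div_iff₀ (by positivity)] at h7
  nlinarith [norm_nonneg (w - ζ)]

theorem differentiable_apply_coherent (T : 𝓢'(ℝ, ℂ)) :
    Differentiable ℂ fun ζ => T (coherent ζ) := by
  intro ζ
  refine HasDerivAt.differentiableAt (f' := T (coherentDeriv ζ)) ?_
  rw [hasDerivAt_iff_tendsto_slope]
  have h1 : Continuous T := map_continuous T
  have h := (h1.tendsto (coherentDeriv ζ)).comp (tendsto_slope_coherent ζ)
  refine h.congr fun w => ?_
  simp [slope_def_module]

theorem norm_stft_eq (T : 𝓢'(ℝ, ℂ)) (ζ : ℂ) :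
    ‖stft gaussWindow T ζ.re ζ.im‖ = Real.exp (-(Real.pi * ζ.re ^ 2)) * ‖T (coherent ζ)‖ := by
  rw [coherent, map_smul, norm_smul, Complex.norm_real, Real.norm_of_nonneg (by positivity),
    ← mul_assoc, ← Real.exp_add]
  simp [stft]

theorem continuous_norm_stft (T : 𝓢'(ℝ, ℂ)) :
    Continuous fun z : ℝ × ℝ => ‖stft gaussWindow T z.1 z.2‖ := by
  have h := (differentiable_apply_coherent T).continuous
  have h2 : Continuous fun z : ℝ × ℝ => (⟨z.1, z.2⟩ : ℂ) :=
    Complex.equivRealProdCLM.symm.continuous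
  have h3 : ∀ z : ℝ × ℝ, ‖stft gaussWindow T z.1 z.2‖ =
      Real.exp (-(Real.pi * z.1 ^ 2)) * ‖T (coherent ⟨z.1, z.2⟩)‖ := fun z =>
    norm_stft_eq T ⟨z.1, z.2⟩
  simp only [h3]
  have h4 := h.comp h2
  exact Continuous.mul (by fun_prop) h4.norm


/-! ### Exponential square moments of Gaussian variables -/

open ProbabilityTheory NNReal in
theorem lintegral_exp_sq_gaussianReal_le (v : ℝ≥0) (c : ℝ) (hc : 2 * c * v ≤ 15 / 16) :
    ∫⁻ x, ENNReal.ofReal (Real.exp (c * x ^ 2)) ∂gaussianReal 0 v ≤ 4 := by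
  rcases eq_or_ne v 0 with rfl | hv
  · rw [gaussianReal_zero_var, lintegral_dirac]
    simp
  have hv0 : (0 : ℝ) < v := by positivity
  set b : ℝ := 1 / (2 * v) - c with hb
  have hbv : 1 / 16 ≤ 2 * v * b := by
    rw [hb, mul_sub, mul_one_div_cancel (by positivity)]; linarith
  have hb0 : 0 < b := by
    by_contra h
    nlinarith
  rw [gaussianReal_of_var_ne_zero 0 hv, lintegral_withDensity_eq_lintegral_mul _
    (measurable_gaussianPDF 0 v) (by fun_prop)]
  have e : ∀ x : ℝ, (gaussianPDF 0 v * fun x => ENNReal.ofReal (Real.exp (c * x ^ 2))) x =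
      ENNReal.ofReal ((√(2 * Real.pi * v))⁻¹ * Real.exp (-b * x ^ 2)) := by
    intro x
    rw [Pi.mul_apply, gaussianPDF, ← ENNReal.ofReal_mul (gaussianPDFReal_nonneg _ _ _),
      gaussianPDFReal, mul_assoc, ← Real.exp_add]
    congr 3
    rw [hb]; field_simp; ring
  rw [lintegral_congr e, ← ofReal_integral_eq_lintegral_ofReal
    ((integrable_exp_neg_mul_sq hb0).const_mul _) (Filter.Eventually.of_forall fun x => by positivity),
    integral_const_mul, integral_gaussian]
  have h4 : (4 : ENNReal) = ENNReal.ofReal 4 := by norm_num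
  rw [h4]
  apply ENNReal.ofReal_le_ofReal
  rw [inv_mul_le_iff₀ (by positivity), mul_comm]
  rw [Real.sqrt_le_left (by positivity), mul_pow, Real.sq_sqrt (by positivity), div_le_iff₀ hb0]
  nlinarith [Real.pi_pos, mul_le_mul_of_nonneg_left hbv Real.pi_pos.le]

theorem measurable_apply (φ : 𝓢(ℝ, ℂ)) : Measurable fun ξ : 𝓢'(ℝ, ℂ) => ξ φ :=
  (PointwiseConvergenceCLM.evalCLM (RingHom.id ℂ) ℂ φ).continuous.measurable

open ProbabilityTheory in
theorem IsWhiteNoise.map_re {μ : Measure 𝓢'(ℝ, ℂ)} (hμ : IsWhiteNoise μ) {φ : 𝓢(ℝ, ℂ)}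
    (hφ : ∀ t, (φ t).im = 0) :
    μ.map (fun ξ => (ξ φ).re) = gaussianReal 0 (∫ t : ℝ, ‖φ t‖ ^ 2).toNNReal := by
  have := hμ.isProbabilityMeasure
  have hm : Measurable fun ξ : 𝓢'(ℝ, ℂ) => (ξ φ).re := Complex.measurable_re.comp (measurable_apply φ)
  have : IsProbabilityMeasure (μ.map fun ξ => (ξ φ).re) := Measure.isProbabilityMeasure_map hm.aemeasurable
  apply Measure.ext_of_charFun
  funext s
  rw [charFun_gaussianReal, charFun_apply_real, integral_map hm.aemeasurable (by fun_prop)]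
  have h := hμ.charFun ((s : ℂ) • φ) (fun t => by simp [hφ])
  have e1 : ∫ ξ, Complex.exp (s * ((ξ φ).re : ℝ) * Complex.I) ∂μ =
      ∫ ξ, Complex.exp (Complex.I * ξ ((s : ℂ) • φ)) ∂μ := by
    apply integral_congr_ae
    filter_upwards [hμ.real φ hφ] with ξ hξ
    have : ξ φ = ((ξ φ).re : ℂ) := Complex.ext rfl (by simpa using hξ)
    rw [map_smul, this]
    congr 1
    simp only [Complex.ofReal_re, smul_eq_mul]; ring
  rw [e1, h]
  have e2 : ∫ t : ℝ, ‖((s : ℂ) • φ) t‖ ^ 2 = s ^ 2 * ∫ t : ℝ, ‖φ t‖ ^ 2 := by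
    rw [← integral_const_mul]
    congr 1; funext t
    rw [smul_apply, norm_smul, mul_pow, Complex.norm_real, Real.norm_eq_abs, sq_abs]
  rw [e2, Real.coe_toNNReal _ (integral_nonneg fun t => by positivity)]
  congr 1
  push_cast
  ring

theorem IsWhiteNoise.lintegral_exp_sq_re_le {μ : Measure 𝓢'(ℝ, ℂ)} (hμ : IsWhiteNoise μ)
    {φ : 𝓢(ℝ, ℂ)} (hφ : ∀ t, (φ t).im = 0) (c : ℝ) (hc : 2 * c * ∫ t : ℝ, ‖φ t‖ ^ 2 ≤ 15 / 16) :
    ∫⁻ ξ, ENNReal.ofReal (Real.exp (c * (ξ φ).re ^ 2)) ∂μ ≤ 4 := by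
  have hm : Measurable fun ξ : 𝓢'(ℝ, ℂ) => (ξ φ).re := Complex.measurable_re.comp (measurable_apply φ)
  have h := lintegral_map (μ := μ) (g := fun ξ => (ξ φ).re)
    (f := fun x : ℝ => ENNReal.ofReal (Real.exp (c * x ^ 2))) (by fun_prop) hm
  rw [← h, hμ.map_re hφ]
  apply lintegral_exp_sq_gaussianReal_le
  rwa [Real.coe_toNNReal _ (integral_nonneg fun t => by positivity)]

/-- The real part of a Schwartz function. -/
noncomputable def schwartzRe (φ : 𝓢(ℝ, ℂ)) : 𝓢(ℝ, ℂ) :=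
  SchwartzMap.postcompCLM (𝕜 := ℝ) (Complex.ofRealCLM.comp Complex.reCLM) φ

/-- The imaginary part of a Schwartz function. -/
noncomputable def schwartzIm (φ : 𝓢(ℝ, ℂ)) : 𝓢(ℝ, ℂ) :=
  SchwartzMap.postcompCLM (𝕜 := ℝ) (Complex.ofRealCLM.comp Complex.imCLM) φ

@[simp] theorem schwartzRe_apply (φ : 𝓢(ℝ, ℂ)) (t : ℝ) : schwartzRe φ t = ((φ t).re : ℂ) := rfl

@[simp] theorem schwartzIm_apply (φ : 𝓢(ℝ, ℂ)) (t : ℝ) : schwartzIm φ t = ((φ t).im : ℂ) := rfl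

theorem schwartzRe_add_schwartzIm (φ : 𝓢(ℝ, ℂ)) :
    schwartzRe φ + Complex.I • schwartzIm φ = φ := by
  ext t
  simp only [add_apply, smul_apply, schwartzRe_apply, schwartzIm_apply, smul_eq_mul]
  rw [mul_comm, Complex.re_add_im]

theorem integrable_norm_sq_schwartz (φ : 𝓢(ℝ, ℂ)) : Integrable fun t : ℝ => ‖φ t‖ ^ 2 :=
  (φ.memLp 2 volume).integrable_norm_pow (by norm_num)

theorem IsWhiteNoise.lintegral_exp_norm_sq_le {μ : Measure 𝓢'(ℝ, ℂ)} (hμ : IsWhiteNoise μ)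
    {φ : 𝓢(ℝ, ℂ)} (hφ : ∫ t : ℝ, ‖φ t‖ ^ 2 = 1) {a : ℝ} (ha : a ≤ 5 / 12) :
    ∫⁻ ξ, ENNReal.ofReal (Real.exp (a * ‖ξ φ‖ ^ 2)) ∂μ ≤ 4 := by
  set p := ∫ t : ℝ, ‖schwartzRe φ t‖ ^ 2 with hp
  set q := ∫ t : ℝ, ‖schwartzIm φ t‖ ^ 2 with hq
  have hp0 : 0 ≤ p := integral_nonneg fun t => by positivity
  have hq0 : 0 ≤ q := integral_nonneg fun t => by positivity
  have hpq : p + q = 1 := by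
    rw [hp, hq, ← integral_add (integrable_norm_sq_schwartz _) (integrable_norm_sq_schwartz _), ← hφ]
    congr 1; funext t
    rw [schwartzRe_apply, schwartzIm_apply, Complex.norm_real, Complex.norm_real, Real.norm_eq_abs,
      Real.norm_eq_abs, sq_abs, sq_abs, ← Complex.normSq_eq_norm_sq, Complex.normSq_apply]
    ring
  obtain ⟨α, hα⟩ : ∃ α, α = 8 / 9 * (p + 1 / 16) := ⟨_, rfl⟩
  obtain ⟨β, hβ⟩ : ∃ β, β = 8 / 9 * (q + 1 / 16) := ⟨_, rfl⟩
  have hα0 : 0 < α := by rw [hα]; positivity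
  have hβ0 : 0 < β := by rw [hβ]; positivity
  have hαβ : α + β = 1 := by rw [hα, hβ]; linarith
  have hre := hμ.lintegral_exp_sq_re_le (φ := schwartzRe φ) (fun t => by simp) (a / α) (by
    rw [← hp, mul_div_assoc', div_mul_eq_mul_div, div_le_iff₀ hα0, hα]
    nlinarith)
  have him := hμ.lintegral_exp_sq_re_le (φ := schwartzIm φ) (fun t => by simp) (a / β) (by
    rw [← hq, mul_div_assoc', div_mul_eq_mul_div, div_le_iff₀ hβ0, hβ]
    nlinarith)
  have hmeas : ∀ (ψ : 𝓢(ℝ, ℂ)) (c : ℝ), Measurable fun ξ : 𝓢'(ℝ, ℂ) =>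
      ENNReal.ofReal (Real.exp (c * (ξ ψ).re ^ 2)) := fun ψ c =>
    (((Complex.measurable_re.comp (measurable_apply ψ)).pow_const 2).const_mul c).exp.ennreal_ofReal
  calc ∫⁻ ξ, ENNReal.ofReal (Real.exp (a * ‖ξ φ‖ ^ 2)) ∂μ
      ≤ ∫⁻ ξ, (ENNReal.ofReal α * ENNReal.ofReal (Real.exp (a / α * (ξ (schwartzRe φ)).re ^ 2)) +
          ENNReal.ofReal β * ENNReal.ofReal (Real.exp (a / β * (ξ (schwartzIm φ)).re ^ 2))) ∂μ := by
        apply lintegral_mono_ae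
        filter_upwards [hμ.real (schwartzRe φ) (fun t => by simp),
          hμ.real (schwartzIm φ) (fun t => by simp)] with ξ h1 h2
        rw [← ENNReal.ofReal_mul hα0.le, ← ENNReal.ofReal_mul hβ0.le,
          ← ENNReal.ofReal_add (by positivity) (by positivity)]
        apply ENNReal.ofReal_le_ofReal
        have h3 : ‖ξ φ‖ ^ 2 = (ξ (schwartzRe φ)).re ^ 2 + (ξ (schwartzIm φ)).re ^ 2 := by
          conv_lhs => rw [← schwartzRe_add_schwartzIm φ]
          rw [map_add, map_smul, ← Complex.normSq_eq_norm_sq, Complex.normSq_apply]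
          simp [h1, h2]
          ring
        have h4 := convexOn_exp.2 (Set.mem_univ (a / α * (ξ (schwartzRe φ)).re ^ 2))
          (Set.mem_univ (a / β * (ξ (schwartzIm φ)).re ^ 2)) hα0.le hβ0.le hαβ
        simp only [smul_eq_mul] at h4
        refine le_trans (le_of_eq ?_) h4
        rw [h3]
        congr 1
        field_simp
    _ = ENNReal.ofReal α * ∫⁻ ξ, ENNReal.ofReal (Real.exp (a / α * (ξ (schwartzRe φ)).re ^ 2)) ∂μ +
          ENNReal.ofReal β * ∫⁻ ξ, ENNReal.ofReal (Real.exp (a / β * (ξ (schwartzIm φ)).re ^ 2)) ∂μ := by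
        rw [lintegral_add_left ((hmeas _ _).const_mul _), lintegral_const_mul _ (hmeas _ _),
          lintegral_const_mul _ (hmeas _ _)]
    _ ≤ ENNReal.ofReal α * 4 + ENNReal.ofReal β * 4 := by gcongr
    _ = 4 := by
        rw [← add_mul, ← ENNReal.ofReal_add hα0.le hβ0.le, hαβ]; simp

theorem integral_norm_sq_tfShift (u v : ℝ) : ∫ t : ℝ, ‖tfShift u v gaussWindow t‖ ^ 2 = 1 := by
  have h : ∀ t : ℝ, ‖tfShift u v gaussWindow t‖ ^ 2 =
      √2 * Real.exp (-(2 * Real.pi) * (t - u) ^ 2) := by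
    intro t
    rw [tfShift_apply, norm_mul]
    have h2 : (2 * Real.pi * Complex.I * v * t : ℂ) =
        ((2 * Real.pi * v * t : ℝ) : ℂ) * Complex.I := by push_cast; ring
    rw [h2, Complex.norm_exp_ofReal_mul_I, one_mul, gaussWindow, schwartzOfGauss_apply,
      Complex.norm_real, Real.norm_eq_abs, sq_abs, gaussFun, mul_pow, ← Real.exp_nat_mul,
      ← Real.rpow_natCast, ← Real.rpow_mul (by norm_num), Real.sqrt_eq_rpow]
    congr 2
    · norm_num
    · push_cast; ring
  simp only [h]
  rw [integral_const_mul, integral_sub_right_eq_self (fun t => Real.exp (-(2 * Real.pi) * t ^ 2)) u,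
    integral_gaussian, ← Real.sqrt_mul (by norm_num)]
  have : 2 * (Real.pi / (2 * Real.pi)) = 1 := by field_simp
  rw [this, Real.sqrt_one]

theorem IsWhiteNoise.lintegral_exp_stft_le {μ : Measure 𝓢'(ℝ, ℂ)} (hμ : IsWhiteNoise μ)
    (u v : ℝ) {a : ℝ} (ha : a ≤ 5 / 12) :
    ∫⁻ ξ, ENNReal.ofReal (Real.exp (a * ‖stft gaussWindow ξ u v‖ ^ 2)) ∂μ ≤ 4 :=
  hμ.lintegral_exp_norm_sq_le (integral_norm_sq_tfShift u v) ha


/-! ### A uniform tail bound for the Gabor transform of white noise -/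

/-- A sub-mean value inequality for `exp (b |G|²)`, `G` entire. -/
theorem exp_norm_sq_le_circle_integral {G : ℂ → ℂ} (hG : Differentiable ℂ G) {b ρ : ℝ} (hb : 0 ≤ b)
    (hρ : 0 < ρ) {c z : ℂ} (hz : ‖z - c‖ ≤ ρ / 2) :
    Real.exp (b * ‖G z‖ ^ 2) ≤
      Real.pi⁻¹ * ∫ θ in (0 : ℝ)..2 * Real.pi, Real.exp (b * ‖G (circleMap c ρ θ)‖ ^ 2) := by
  set f : ℂ → ℂ := fun w => Complex.exp (2 * b * (starRingEnd ℂ) (G z) * G w) with hf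
  have hfd : Differentiable ℂ f := (hG.const_mul _).cexp
  have hzb : z ∈ Metric.ball c ρ := by
    rw [mem_ball_iff_norm]; linarith
  have hC := hfd.diffContOnCl.two_pi_i_inv_smul_circleIntegral_sub_inv_smul (R := ρ) hzb
  set E := Real.exp (b * ‖G z‖ ^ 2) with hE
  have hE0 : 0 < E := Real.exp_pos _
  have hfz : ‖f z‖ = E * E := by
    rw [hf, hE, ← Real.exp_add]
    simp only
    rw [mul_assoc, mul_comm ((starRingEnd ℂ) (G z)), Complex.mul_conj, Complex.norm_exp,
      Complex.normSq_eq_norm_sq]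
    congr 1
    have : (2 * (b : ℂ) * ((‖G z‖ ^ 2 : ℝ) : ℂ)) = ((2 * b * ‖G z‖ ^ 2 : ℝ) : ℂ) := by push_cast; ring
    rw [this, Complex.ofReal_re]; ring
  have hfw : ∀ w, ‖f w‖ ≤ E * Real.exp (b * ‖G w‖ ^ 2) := by
    intro w
    rw [hE, ← Real.exp_add]
    refine (Complex.norm_exp_le_exp_norm _).trans (Real.exp_le_exp.mpr ?_)
    rw [norm_mul, norm_mul, norm_mul, RCLike.norm_conj, Complex.norm_real, Real.norm_of_nonneg hb]
    simp only [Complex.norm_ofNat]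
    nlinarith [mul_nonneg hb (sq_nonneg (‖G z‖ - ‖G w‖))]
  have hcont : Continuous fun θ : ℝ => Real.exp (b * ‖G (circleMap c ρ θ)‖ ^ 2) := by
    have := hG.continuous.comp (continuous_circleMap c ρ)
    exact Real.continuous_exp.comp (continuous_const.mul (this.norm.pow 2))
  have h2π : (0 : ℝ) ≤ 2 * Real.pi := by positivity
  have hbound : ‖∮ w in C(c, ρ), (w - z)⁻¹ • f w‖ ≤
      ∫ θ in (0 : ℝ)..2 * Real.pi, 2 * E * Real.exp (b * ‖G (circleMap c ρ θ)‖ ^ 2) := by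
    rw [circleIntegral]
    refine intervalIntegral.norm_integral_le_of_norm_le h2π ?_
      ((continuous_const.mul hcont).intervalIntegrable _ _)
    refine Filter.Eventually.of_forall fun θ _ => ?_
    have h1 : ρ / 2 ≤ ‖circleMap c ρ θ - z‖ := by
      have h2 : ‖circleMap c ρ θ - c‖ = ρ := by simp [circleMap, abs_of_pos hρ]
      have h3 : ‖circleMap c ρ θ - c‖ ≤ ‖circleMap c ρ θ - z‖ + ‖z - c‖ := norm_sub_le_norm_sub_add_norm_sub _ _ _
      linarith
    rw [norm_smul, norm_smul, norm_inv, deriv_circleMap, norm_mul, norm_circleMap_zero,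
      Complex.norm_I, mul_one, abs_of_pos hρ]
    calc ρ * (‖circleMap c ρ θ - z‖⁻¹ * ‖f (circleMap c ρ θ)‖)
        ≤ ρ * ((ρ / 2)⁻¹ * (E * Real.exp (b * ‖G (circleMap c ρ θ)‖ ^ 2))) := by
          gcongr
          exact hfw _
      _ = _ := by field_simp
  rw [intervalIntegral.integral_const_mul] at hbound
  have h3 : ‖f z‖ ≤ (2 * Real.pi)⁻¹ * (2 * E *
      ∫ θ in (0 : ℝ)..2 * Real.pi, Real.exp (b * ‖G (circleMap c ρ θ)‖ ^ 2)) := by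
    rw [← hC, norm_smul]
    have : ‖((2 * Real.pi * Complex.I : ℂ))⁻¹‖ = (2 * Real.pi)⁻¹ := by
      simp [abs_of_pos Real.pi_pos]
    rw [this]
    gcongr
  rw [hfz] at h3
  have h4 : (2 * Real.pi)⁻¹ * (2 * E *
      ∫ θ in (0 : ℝ)..2 * Real.pi, Real.exp (b * ‖G (circleMap c ρ θ)‖ ^ 2)) =
      E * (Real.pi⁻¹ * ∫ θ in (0 : ℝ)..2 * Real.pi, Real.exp (b * ‖G (circleMap c ρ θ)‖ ^ 2)) := by
    field_simp
  rw [h4] at h3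
  exact le_of_mul_le_mul_left h3 hE0

theorem exp_two_pi_div_le : Real.exp (2 * Real.pi * (1 / 8) ^ 2) ≤ 5 / 3 := by
  have h1 : Real.exp (2 * Real.pi * (1 / 8) ^ 2) ≤ Real.exp (1 / 10) := by
    apply Real.exp_le_exp.mpr
    linarith [Real.pi_lt_d2]
  have h2 := Real.add_one_le_exp (-(1 / 10) : ℝ)
  have h3 : Real.exp (1 / 10) * Real.exp (-(1 / 10)) = 1 := by rw [← Real.exp_add]; simp
  nlinarith [Real.exp_pos (1 / 10)]

theorem continuous_norm_stft_circleMap (T : 𝓢'(ℝ, ℂ)) (c : ℂ) (ρ : ℝ) :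
    Continuous fun θ : ℝ => ‖stft gaussWindow T (circleMap c ρ θ).re (circleMap c ρ θ).im‖ := by
  have h1 : Continuous fun θ : ℝ => ((circleMap c ρ θ).re, (circleMap c ρ θ).im) :=
    (Complex.continuous_re.comp (continuous_circleMap c ρ)).prodMk
      (Complex.continuous_im.comp (continuous_circleMap c ρ))
  have h2 := (continuous_norm_stft T).comp h1
  simpa only [Function.comp_def] using h2

theorem exp_norm_stft_sq_le_circle_integral (T : 𝓢'(ℝ, ℂ)) {c z : ℂ} (hz : ‖z - c‖ ≤ 1 / 16) :
    Real.exp (1 / 4 * ‖stft gaussWindow T z.re z.im‖ ^ 2) ≤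
      Real.pi⁻¹ * ∫ θ in (0 : ℝ)..2 * Real.pi,
        Real.exp (5 / 12 * ‖stft gaussWindow T (circleMap c (1 / 8) θ).re
          (circleMap c (1 / 8) θ).im‖ ^ 2) := by
  set G : ℂ → ℂ := fun w => T (coherent w) *
    Complex.exp (-(Real.pi * (c.re : ℂ) ^ 2) - 2 * Real.pi * c.re * (w - c.re)) with hGdef
  have hG : Differentiable ℂ G := (differentiable_apply_coherent T).mul (by fun_prop)
  have hGn : ∀ w, ‖G w‖ = ‖stft gaussWindow T w.re w.im‖ * Real.exp (Real.pi * (w.re - c.re) ^ 2) := by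
    intro w
    have h1 : (-(Real.pi * (c.re : ℂ) ^ 2) - 2 * Real.pi * c.re * (w - c.re) : ℂ).re =
        -(Real.pi * c.re ^ 2) - 2 * Real.pi * c.re * (w.re - c.re) := by
      have : (-(Real.pi * (c.re : ℂ) ^ 2) - 2 * Real.pi * c.re * (w - c.re) : ℂ) =
        ((-(Real.pi * c.re ^ 2) : ℝ) : ℂ) - ((2 * Real.pi * c.re : ℝ) : ℂ) * (w - c.re) := by
        push_cast; ring
      rw [this, Complex.sub_re, Complex.re_ofReal_mul, Complex.ofReal_re, Complex.sub_re,
        Complex.ofReal_re]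
    rw [hGdef, norm_mul, Complex.norm_exp, h1, norm_stft_eq, mul_comm (Real.exp _) ‖_‖,
      mul_assoc ‖_‖, ← Real.exp_add]
    congr 2
    ring
  have hmain := exp_norm_sq_le_circle_integral hG (b := 1 / 4) (ρ := 1 / 8) (by norm_num)
    (by norm_num) (c := c) (z := z) (by linarith)
  have hVc := continuous_norm_stft_circleMap T c (1 / 8)
  calc Real.exp (1 / 4 * ‖stft gaussWindow T z.re z.im‖ ^ 2)
      ≤ Real.exp (1 / 4 * ‖G z‖ ^ 2) := by
        rw [hGn]
        gcongr
        exact le_mul_of_one_le_right (norm_nonneg _) (Real.one_le_exp (by positivity))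
    _ ≤ _ := hmain
    _ ≤ _ := by
        gcongr ?_ * ?_
        refine intervalIntegral.integral_mono_on (by positivity) ?_ ?_ fun θ _ => ?_
        · have := hG.continuous.comp (continuous_circleMap c (1 / 8))
          exact (Real.continuous_exp.comp
            (continuous_const.mul (this.norm.pow 2))).intervalIntegrable _ _
        · exact (Real.continuous_exp.comp
            (continuous_const.mul (hVc.pow 2))).intervalIntegrable _ _
        · rw [hGn, mul_pow, ← Real.exp_nat_mul]
          apply Real.exp_le_exp.mpr
          have h1 : ((circleMap c (1 / 8) θ).re - c.re) ^ 2 ≤ (1 / 8) ^ 2 := by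
            rw [← Complex.sub_re, ← sq_abs]
            have h2 := Complex.abs_re_le_norm (circleMap c (1 / 8) θ - c)
            have h3 : ‖circleMap c (1 / 8) θ - c‖ = 1 / 8 := by simp [circleMap]
            rw [h3] at h2
            gcongr
          have h4 : Real.exp (((2 : ℕ) : ℝ) * (Real.pi * ((circleMap c (1 / 8) θ).re - c.re) ^ 2)) ≤ 5 / 3 := by
            refine le_trans (Real.exp_le_exp.mpr ?_) exp_two_pi_div_le
            push_cast
            nlinarith [Real.pi_pos, mul_le_mul_of_nonneg_left h1 Real.pi_pos.le]
          nlinarith [sq_nonneg ‖stft gaussWindow T (circleMap c (1 / 8) θ).re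
            (circleMap c (1 / 8) θ).im‖, mul_le_mul_of_nonneg_left h4
              (sq_nonneg ‖stft gaussWindow T (circleMap c (1 / 8) θ).re (circleMap c (1 / 8) θ).im‖)]

theorem measurable_norm_stft (u v : ℝ) :
    Measurable fun ξ : 𝓢'(ℝ, ℂ) => ‖stft gaussWindow ξ u v‖ :=
  (measurable_apply (tfShift u v gaussWindow)).norm

/-- Markov's inequality for the average over `θ ∈ (0, 2π]` of a family of random variables. -/
theorem measure_ge_lintegral_circle_le {Ω : Type*} [MeasurableSpace Ω] {μ : Measure Ω} [SFinite μ]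
    {J : ℝ → Ω → ENNReal} (hJ : Measurable (Function.uncurry J)) {C s : ℝ} (hC : 0 ≤ C) (hs : 0 < s)
    (h : ∀ θ, ∫⁻ x, J θ x ∂μ ≤ ENNReal.ofReal C) :
    μ {x | ENNReal.ofReal s ≤ ENNReal.ofReal Real.pi⁻¹ * ∫⁻ θ in Set.Ioc 0 (2 * Real.pi), J θ x} ≤
      ENNReal.ofReal (2 * C / s) := by
  have hJ' : Measurable fun p : Ω × ℝ => J p.2 p.1 := hJ.comp measurable_swap
  have hm : Measurable fun x => ∫⁻ θ in Set.Ioc 0 (2 * Real.pi), J θ x := hJ'.lintegral_prod_right'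
  have hint : ∫⁻ x, (ENNReal.ofReal Real.pi⁻¹ * ∫⁻ θ in Set.Ioc 0 (2 * Real.pi), J θ x) ∂μ ≤
      ENNReal.ofReal (2 * C) := by
    rw [lintegral_const_mul _ hm, lintegral_lintegral_swap hJ'.aemeasurable]
    calc ENNReal.ofReal Real.pi⁻¹ * ∫⁻ θ in Set.Ioc 0 (2 * Real.pi), ∫⁻ x, J θ x ∂μ
        ≤ ENNReal.ofReal Real.pi⁻¹ * ∫⁻ θ in Set.Ioc 0 (2 * Real.pi), ENNReal.ofReal C := by
          gcongr with θ
          exact h θ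
      _ = ENNReal.ofReal (2 * C) := by
          rw [setLIntegral_const, Real.volume_Ioc, sub_zero, ← ENNReal.ofReal_mul hC,
            ← ENNReal.ofReal_mul (by positivity)]
          congr 1
          field_simp
  have hmk := mul_meas_ge_le_lintegral (hm.const_mul (ENNReal.ofReal Real.pi⁻¹))
    (ENNReal.ofReal s) (μ := μ)
  rw [ENNReal.ofReal_div_of_pos hs, ENNReal.le_div_iff_mul_le (Or.inl (by positivity))
    (Or.inl ENNReal.ofReal_ne_top), mul_comm]
  exact hmk.trans hint

theorem measurable_uncurry_norm_stft_circleMap (c : ℂ) (ρ : ℝ) :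
    Measurable (Function.uncurry fun (θ : ℝ) (ξ : 𝓢'(ℝ, ℂ)) =>
      ‖stft gaussWindow ξ (circleMap c ρ θ).re (circleMap c ρ θ).im‖) :=
  measurable_uncurry_of_continuous_of_measurable
    (fun ξ => continuous_norm_stft_circleMap ξ c ρ) fun _ => measurable_norm_stft _ _

theorem IsWhiteNoise.measure_disc_le {μ : Measure 𝓢'(ℝ, ℂ)} (hμ : IsWhiteNoise μ) (c : ℂ) {r : ℝ}
    (hr : 0 ≤ r) :
    μ {ξ | ∃ z : ℂ, ‖z - c‖ ≤ 1 / 16 ∧ r ≤ ‖stft gaussWindow ξ z.re z.im‖} ≤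
      ENNReal.ofReal (8 * Real.exp (-(r ^ 2 / 4))) := by
  have := hμ.isProbabilityMeasure
  have hJ := (((measurable_uncurry_norm_stft_circleMap c (1 / 8)).pow_const 2).const_mul
    (5 / 12)).exp.ennreal_ofReal
  have hmk := measure_ge_lintegral_circle_le (μ := μ) (C := 4) (s := Real.exp (r ^ 2 / 4))
    (J := fun θ ξ => ENNReal.ofReal (Real.exp (5 / 12 * ‖stft gaussWindow ξ
      (circleMap c (1 / 8) θ).re (circleMap c (1 / 8) θ).im‖ ^ 2))) hJ (by norm_num)
    (Real.exp_pos _) (fun θ => by simpa using hμ.lintegral_exp_stft_le _ _ le_rfl)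
  have e : 2 * 4 / Real.exp (r ^ 2 / 4) = 8 * Real.exp (-(r ^ 2 / 4)) := by
    rw [Real.exp_neg]; ring
  rw [e] at hmk
  refine (measure_mono ?_).trans hmk
  rintro ξ ⟨z, hz, hrz⟩
  have h1 := exp_norm_stft_sq_le_circle_integral ξ hz
  have h2 : Real.exp (r ^ 2 / 4) ≤ Real.exp (1 / 4 * ‖stft gaussWindow ξ z.re z.im‖ ^ 2) := by
    apply Real.exp_le_exp.mpr
    nlinarith
  refine (ENNReal.ofReal_le_ofReal (h2.trans h1)).trans (le_of_eq ?_)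
  have hc := Real.continuous_exp.comp (continuous_const.mul
    ((continuous_norm_stft_circleMap ξ c (1 / 8)).pow 2) : Continuous fun θ => (5 / 12 : ℝ) * _)
  rw [ENNReal.ofReal_mul (by positivity), intervalIntegral.integral_of_le (by positivity),
    ofReal_integral_eq_lintegral_ofReal]
  · exact hc.integrableOn_Icc.mono_set Set.Ioc_subset_Icc_self
  · exact Filter.Eventually.of_forall fun θ => (Real.exp_pos _).le

theorem IsWhiteNoise.measure_square_le {μ : Measure 𝓢'(ℝ, ℂ)} (hμ : IsWhiteNoise μ) {L r : ℝ}
    (hL : 3 ≤ L) (hr : 0 ≤ r) :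
    μ {ξ | ∃ u v : ℝ, max |u| |v| ≤ L ∧ r ≤ ‖stft gaussWindow ξ u v‖} ≤
      ENNReal.ofReal ((34 * L) ^ 2 * (8 * Real.exp (-(r ^ 2 / 4)))) := by
  set m : ℤ := ⌈16 * L⌉ + 1 with hm
  have hm0 : 16 * L + 1 ≤ m := by rw [hm]; push_cast; linarith [Int.le_ceil (16 * L)]
  have hm1 : (m : ℝ) < 16 * L + 2 := by rw [hm]; push_cast; linarith [Int.ceil_lt_add_one (16 * L)]
  have hround : ∀ u : ℝ, |u| ≤ L → round (16 * u) ∈ Finset.Icc (-m) m ∧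
      |u - (round (16 * u) : ℝ) / 16| ≤ 1 / 32 := by
    intro u hu
    have h1 := abs_le.mp (abs_sub_round (16 * u))
    have h2 := abs_le.mp hu
    refine ⟨Finset.mem_Icc.mpr ⟨?_, ?_⟩, abs_le.mpr ⟨by linarith, by linarith⟩⟩
    · have : (-m : ℝ) ≤ round (16 * u) := by linarith
      exact_mod_cast this
    · have : (round (16 * u) : ℝ) ≤ m := by linarith
      exact_mod_cast this
  set I : Finset (ℤ × ℤ) := Finset.Icc (-m) m ×ˢ Finset.Icc (-m) m with hI
  have hsub : {ξ : 𝓢'(ℝ, ℂ) | ∃ u v : ℝ, max |u| |v| ≤ L ∧ r ≤ ‖stft gaussWindow ξ u v‖} ⊆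
      ⋃ i ∈ I, {ξ | ∃ z : ℂ, ‖z - ⟨(i.1 : ℝ) / 16, (i.2 : ℝ) / 16⟩‖ ≤ 1 / 16 ∧
        r ≤ ‖stft gaussWindow ξ z.re z.im‖} := by
    rintro ξ ⟨u, v, huv, h⟩
    obtain ⟨hu1, hu2⟩ := hround u ((le_max_left _ _).trans huv)
    obtain ⟨hv1, hv2⟩ := hround v ((le_max_right _ _).trans huv)
    refine Set.mem_iUnion₂.mpr ⟨(round (16 * u), round (16 * v)),
      Finset.mem_product.mpr ⟨hu1, hv1⟩, ⟨u, v⟩, ?_, h⟩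
    refine (Complex.norm_le_abs_re_add_abs_im _).trans ?_
    simp only [Complex.sub_re, Complex.sub_im]
    linarith
  have hcard : (I.card : ℝ) ≤ (34 * L) ^ 2 := by
    have h1 : ((m + 1 - -m).toNat : ℝ) = 2 * m + 1 := by
      have h2 : (((m + 1 - -m).toNat : ℤ)) = 2 * m + 1 := by
        rw [Int.toNat_of_nonneg]; · ring
        · have : (0 : ℝ) ≤ m := by linarith
          have : 0 ≤ m := by exact_mod_cast this
          omega
      exact_mod_cast h2
    rw [hI, Finset.card_product, Int.card_Icc]
    push_cast
    rw [h1, ← pow_two]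
    apply pow_le_pow_left₀ <;> linarith
  calc μ _ ≤ μ _ := measure_mono hsub
    _ ≤ ∑ i ∈ I, μ {ξ | ∃ z : ℂ, ‖z - ⟨(i.1 : ℝ) / 16, (i.2 : ℝ) / 16⟩‖ ≤ 1 / 16 ∧
        r ≤ ‖stft gaussWindow ξ z.re z.im‖} := measure_biUnion_finset_le _ _
    _ ≤ ∑ _i ∈ I, ENNReal.ofReal (8 * Real.exp (-(r ^ 2 / 4))) :=
        Finset.sum_le_sum fun i _ => hμ.measure_disc_le _ hr
    _ = ENNReal.ofReal (I.card * (8 * Real.exp (-(r ^ 2 / 4)))) := by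
        rw [Finset.sum_const, nsmul_eq_mul, ENNReal.ofReal_mul (p := (I.card : ℝ)) (by positivity),
          ENNReal.ofReal_natCast]
    _ ≤ _ := by
        apply ENNReal.ofReal_le_ofReal
        gcongr

theorem norm_stft_noiseObs (σ : ℝ) (hσ : 0 ≤ σ) (ξ : 𝓢'(ℝ, ℂ)) (u v : ℝ) :
    ‖stft gaussWindow (noiseObs σ ξ) u v‖ = σ * ‖stft gaussWindow ξ u v‖ := by
  have : stft gaussWindow (noiseObs σ ξ) u v = (σ : ℂ) * stft gaussWindow ξ u v := rfl
  rw [this, norm_mul, Complex.norm_real, Real.norm_of_nonneg hσ]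

theorem covering_mul_exp_le {L τ r : ℝ} (hL : Real.pi ≤ L) (hτ : 0 < τ)
    (hr : (14 + τ) ^ 2 / (2 * Real.pi) * Real.log L ≤ r ^ 2 / 4) :
    (34 * L) ^ 2 * (8 * Real.exp (-(r ^ 2 / 4))) ≤
      4 * Real.exp (-(τ ^ 2 / (2 * Real.pi) * Real.log L)) := by
  have hL3 : 3 < L := Real.pi_gt_three.trans_le hL
  have hlog : 0 ≤ Real.log L := Real.log_nonneg (by linarith)
  have h1 : 30 + τ ^ 2 / (2 * Real.pi) ≤ (14 + τ) ^ 2 / (2 * Real.pi) := by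
    rw [le_div_iff₀ (by positivity), add_mul, div_mul_cancel₀ _ (by positivity)]
    nlinarith [Real.pi_lt_d2]
  have h2 : Real.exp (-(r ^ 2 / 4)) ≤
      Real.exp (-(30 * Real.log L)) * Real.exp (-(τ ^ 2 / (2 * Real.pi) * Real.log L)) := by
    rw [← Real.exp_add]
    apply Real.exp_le_exp.mpr
    nlinarith [mul_le_mul_of_nonneg_right h1 hlog]
  have h3 : Real.exp (-(30 * Real.log L)) = (L ^ 30)⁻¹ := by
    rw [Real.exp_neg]
    congr 1
    have := Real.exp_nat_mul (Real.log L) 30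
    rw [Real.exp_log (by linarith)] at this
    exact_mod_cast this
  have h4 : (34 * L) ^ 2 * 8 ≤ 4 * L ^ 30 := by
    have h5 : (3 : ℝ) ^ 28 ≤ L ^ 28 := by gcongr
    have h6 : L ^ 30 = L ^ 2 * L ^ 28 := by ring
    rw [h6]
    nlinarith [mul_le_mul_of_nonneg_left h5 (sq_nonneg L), sq_nonneg L]
  rw [h3] at h2
  have h7 : (34 * L) ^ 2 * 8 * (L ^ 30)⁻¹ ≤ 4 := by
    rw [← div_eq_mul_inv, div_le_iff₀ (by positivity)]
    exact h4
  calc (34 * L) ^ 2 * (8 * Real.exp (-(r ^ 2 / 4)))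
      ≤ (34 * L) ^ 2 * (8 * ((L ^ 30)⁻¹ * Real.exp (-(τ ^ 2 / (2 * Real.pi) * Real.log L)))) := by
        gcongr
    _ = (34 * L) ^ 2 * 8 * (L ^ 30)⁻¹ * Real.exp (-(τ ^ 2 / (2 * Real.pi) * Real.log L)) := by ring
    _ ≤ _ := by gcongr

/-- The noise exceeds the level `√2 (14 + τ) √(log L)` somewhere on the square with probability at
most `4 exp (-τ² log L / (2π))`. -/
theorem IsWhiteNoise.measureReal_exceed_le {μ : Measure 𝓢'(ℝ, ℂ)} (hμ : IsWhiteNoise μ)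
    {σ L τ : ℝ} (hσ : 0 < σ) (hσ' : σ ≤ √Real.pi) (hL : Real.pi ≤ L) (hτ : 0 < τ) :
    μ.real {ξ | ∃ u v : ℝ, max |u| |v| ≤ L ∧ √2 * (14 + τ) * √(Real.log L) ≤
      ‖stft gaussWindow (noiseObs σ ξ) u v‖} ≤
      4 * Real.exp (-(τ ^ 2 / (2 * Real.pi) * Real.log L)) := by
  have hL3 : 3 < L := Real.pi_gt_three.trans_le hL
  have hlog : 0 ≤ Real.log L := Real.log_nonneg (by linarith)
  set r := √2 * (14 + τ) * √(Real.log L) / σ with hr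
  have hset : {ξ | ∃ u v : ℝ, max |u| |v| ≤ L ∧ √2 * (14 + τ) * √(Real.log L) ≤
      ‖stft gaussWindow (noiseObs σ ξ) u v‖} =
      {ξ | ∃ u v : ℝ, max |u| |v| ≤ L ∧ r ≤ ‖stft gaussWindow ξ u v‖} := by
    ext ξ
    simp only [Set.mem_ofPred_eq, norm_stft_noiseObs σ hσ.le, hr, div_le_iff₀' hσ]
  rw [hset, measureReal_def]
  refine ENNReal.toReal_le_of_le_ofReal (by positivity)
    ((hμ.measure_square_le hL3.le (by positivity)).trans (ENNReal.ofReal_le_ofReal ?_))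
  refine covering_mul_exp_le hL hτ ?_
  have hσ2 : σ ^ 2 ≤ Real.pi := by
    calc σ ^ 2 ≤ √Real.pi ^ 2 := by gcongr
      _ = Real.pi := Real.sq_sqrt Real.pi_pos.le
  rw [hr, div_pow, mul_pow, mul_pow, Real.sq_sqrt hlog, Real.sq_sqrt (by norm_num)]
  have : 2 * (14 + τ) ^ 2 * Real.log L / σ ^ 2 / 4 = (14 + τ) ^ 2 / (2 * σ ^ 2) * Real.log L := by
    field_simp; ring
  rw [this]
  gcongr


/-! ### The Gabor transform of the Hermite functions -/

theorem contDiff_gaussian {n : WithTop ℕ∞} :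
    ContDiff ℝ n fun s : ℝ => Real.exp (-(2 * Real.pi * s ^ 2)) := by fun_prop

/-- The `k`-th derivative of `e^{-2π s²}`. -/
noncomputable def gaussDeriv (k : ℕ) : ℝ → ℝ :=
  iteratedDeriv k fun s : ℝ => Real.exp (-(2 * Real.pi * s ^ 2))

theorem exists_hermiteFun_eq (k : ℕ) : ∃ c : ℝ, c ≠ 0 ∧ ∀ x, hermiteFun k x =
    c * Real.exp (Real.pi * x ^ 2) * gaussDeriv k x := by
  refine ⟨_, ?_, fun x => rfl⟩
  have : 0 < √((2 : ℝ) ^ (2 * (k : ℝ) - 1 / 2) * Real.pi ^ k * (k.factorial : ℝ)) := by positivity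
  exact div_ne_zero (pow_ne_zero _ (by norm_num)) this.ne'

theorem integrable_gaussDeriv_mul_exp (k : ℕ) (ζ : ℂ) :
    Integrable fun t : ℝ =>
      (gaussDeriv k t : ℂ) *
        Complex.exp (2 * Real.pi * ζ * t) := by
  obtain ⟨c, hc, h⟩ := exists_hermiteFun_eq k
  have hint := (SchwartzMap.pairing (ContinuousLinearMap.mul ℝ ℂ) (hermiteSchwartz k)
    (coherent ζ)).integrable (μ := volume)
  have h2 : (2 : ℝ) ^ (1 / 4 : ℝ) ≠ 0 := by positivity
  convert hint.const_mul ((c * (2 : ℝ) ^ (1 / 4 : ℝ) : ℝ) : ℂ)⁻¹ using 2 with t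
  rw [SchwartzMap.pairing_apply_apply, ContinuousLinearMap.mul_apply', coherent_apply,
    hermiteSchwartz, schwartzOfGauss_apply, h]
  have e : Complex.exp (2 * Real.pi * ζ * t) =
      Complex.exp (Real.pi * (t : ℂ) ^ 2) * (Complex.exp (Real.pi * ζ ^ 2) * cgauss (t - ζ)) := by
    rw [cgauss, ← Complex.exp_add, ← Complex.exp_add]
    congr 1; ring
  rw [e, Complex.ofReal_mul, Complex.ofReal_mul, Complex.ofReal_mul, Complex.ofReal_exp,
    Complex.ofReal_mul, Complex.ofReal_pow]
  have hc' : (c : ℂ) ≠ 0 := by exact_mod_cast hc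
  have h2' : (((2 : ℝ) ^ (1 / 4 : ℝ) : ℝ) : ℂ) ≠ 0 := by exact_mod_cast h2
  field_simp

theorem integral_gaussDeriv_mul_exp (k : ℕ) (ζ : ℂ) :
    ∫ t : ℝ, (gaussDeriv k t : ℂ) *
        Complex.exp (2 * Real.pi * ζ * t) =
      (-(2 * Real.pi * ζ)) ^ k * ((1 / 2 : ℂ) ^ (1 / 2 : ℂ) * Complex.exp (Real.pi * ζ ^ 2 / 2)) := by
  induction k with
  | zero =>
    have h := integral_cexp_quadratic (b := -(2 * Real.pi)) (by simp [Real.pi_pos])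
      (2 * Real.pi * ζ) 0
    have hpi : (Real.pi : ℂ) ≠ 0 := by exact_mod_cast Real.pi_ne_zero
    rw [pow_zero, one_mul]
    convert h using 3
    · rw [gaussDeriv, iteratedDeriv_zero, Complex.ofReal_exp, ← Complex.exp_add]
      congr 1; push_cast; ring
    · field_simp
    · field_simp; ring
  | succ k ih =>
    have hu : ∀ t : ℝ, HasDerivAt (fun t : ℝ =>
        (gaussDeriv k t : ℂ))
        (gaussDeriv (k + 1) t : ℂ) t := by
      intro t
      simp only [gaussDeriv]
      rw [iteratedDeriv_succ]
      exact ((contDiff_gaussian (n := ⊤)).differentiable_iteratedDeriv k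
        (WithTop.coe_lt_top _) t).hasDerivAt.ofReal_comp
    have hv : ∀ t : ℝ, HasDerivAt (fun t : ℝ => Complex.exp (2 * Real.pi * ζ * t))
        (2 * Real.pi * ζ * Complex.exp (2 * Real.pi * ζ * t)) t := by
      intro t
      have h2 := ((Complex.ofRealCLM.hasDerivAt (x := t)).const_mul (2 * Real.pi * ζ)).cexp
      simpa [mul_comm] using h2
    have hint := integrable_gaussDeriv_mul_exp k ζ
    have h := integral_mul_deriv_eq_deriv_mul_of_integrable (fun t _ => hu t) (fun t _ => hv t)
      (by
        refine (hint.const_mul (2 * Real.pi * ζ)).congr (Filter.Eventually.of_forall fun t => ?_)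
        simp only [Pi.mul_apply]; ring)
      (integrable_gaussDeriv_mul_exp (k + 1) ζ) hint
    rw [← neg_eq_iff_eq_neg] at h
    rw [← h, pow_succ', mul_assoc (-(2 * Real.pi * ζ)), ← ih, ← integral_const_mul, ← integral_neg]
    congr 1; funext t; ring

/-- The modulus of the Gabor transform of `h_k` is radial. -/
theorem exists_norm_stftFun_hermite_eq (k : ℕ) : ∃ A : ℝ, 0 < A ∧ ∀ u v : ℝ,
    ‖stftFun gaussWindow (hermiteSchwartz k) u v‖ =
      A * (√(u ^ 2 + v ^ 2) ^ k * Real.exp (-(Real.pi * (u ^ 2 + v ^ 2) / 2))) := by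
  obtain ⟨c, hc, h⟩ := exists_hermiteFun_eq k
  have hhalf : (1 / 2 : ℂ) ^ (1 / 2 : ℂ) ≠ 0 := by
    rw [Complex.cpow_def_of_ne_zero (by norm_num)]
    exact Complex.exp_ne_zero _
  refine ⟨|c| * (2 : ℝ) ^ (1 / 4 : ℝ) * (2 * Real.pi) ^ k * ‖(1 / 2 : ℂ) ^ (1 / 2 : ℂ)‖, ?_, ?_⟩
  · have := norm_pos_iff.mpr hhalf
    have := abs_pos.mpr hc
    positivity
  intro u v
  set ζ : ℂ := ⟨u, -v⟩ with hζ
  have hζ' : ζ = u - v * Complex.I := by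
    apply Complex.ext <;> simp [hζ]
  have e : stftFun gaussWindow (hermiteSchwartz k) u v =
      ((c * (2 : ℝ) ^ (1 / 4 : ℝ) * Real.exp (-(Real.pi * u ^ 2)) : ℝ) : ℂ) *
      ∫ t : ℝ, (gaussDeriv k t : ℂ) *
        Complex.exp (2 * Real.pi * ζ * t) := by
    rw [stftFun, ← integral_const_mul]
    congr 1; funext t
    rw [tfShift_apply, map_mul, gaussWindow, schwartzOfGauss_apply, hermiteSchwartz,
      schwartzOfGauss_apply, Complex.conj_ofReal, ← Complex.exp_conj, h, gaussFun]
    have e1 : (starRingEnd ℂ) (2 * Real.pi * Complex.I * v * t) = -(2 * Real.pi * Complex.I * v * t) := by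
      simp [Complex.conj_ofNat]
    have e2 : Complex.exp (Real.pi * (t : ℂ) ^ 2) * (Complex.exp (-(2 * Real.pi * Complex.I * v * t)) *
        Complex.exp (-(Real.pi * ((t : ℂ) - u) ^ 2))) =
        Complex.exp (-(Real.pi * (u : ℂ) ^ 2)) * Complex.exp (2 * Real.pi * ζ * t) := by
      rw [← Complex.exp_add, ← Complex.exp_add, ← Complex.exp_add, hζ']
      congr 1; ring
    rw [e1]
    simp only [Complex.ofReal_mul, Complex.ofReal_exp, Complex.ofReal_neg, Complex.ofReal_pow,
      Complex.ofReal_sub]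
    linear_combination (c : ℂ) * (((2 : ℝ) ^ (1 / 4 : ℝ) : ℝ) : ℂ) *
      (gaussDeriv k t : ℂ) * e2
  have hn : ‖ζ‖ = √(u ^ 2 + v ^ 2) := by
    rw [Complex.norm_def, Complex.normSq_apply, hζ]
    congr 1; ring
  have hre : (Real.pi * ζ ^ 2 / 2 : ℂ).re = Real.pi * (u ^ 2 - v ^ 2) / 2 := by
    have : (Real.pi * ζ ^ 2 / 2 : ℂ) = ((Real.pi / 2 : ℝ) : ℂ) * ζ ^ 2 := by push_cast; ring
    rw [this, Complex.re_ofReal_mul, hζ, pow_two, Complex.mul_re]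
    ring
  have h2π : ‖(2 * Real.pi : ℂ)‖ = 2 * Real.pi := by
    rw [norm_mul, Complex.norm_ofNat, Complex.norm_real, Real.norm_of_nonneg Real.pi_pos.le]
  rw [e, integral_gaussDeriv_mul_exp, norm_mul, norm_mul, norm_mul, Complex.norm_real,
    norm_pow, norm_neg, norm_mul, norm_mul, norm_mul, Complex.norm_exp, hre, hn, h2π, Real.norm_eq_abs c,
    Real.norm_of_nonneg (by positivity), Real.norm_of_nonneg (by positivity)]
  have e3 : Real.exp (-(Real.pi * (u ^ 2 + v ^ 2) / 2)) =
      Real.exp (-(Real.pi * u ^ 2)) * Real.exp (Real.pi * (u ^ 2 - v ^ 2) / 2) := by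
    rw [← Real.exp_add]; congr 1; ring
  rw [e3, mul_pow]
  ring

theorem sqrt_pow_mul_exp_le {k : ℕ} (hk : 1 ≤ k) (s : ℝ) :
    √s ^ k * Real.exp (-(Real.pi * s / 2)) ≤
      √(k / Real.pi) ^ k * Real.exp (-(Real.pi * (k / Real.pi) / 2)) := by
  have hk0 : (0 : ℝ) < k := by exact_mod_cast hk
  have h1 : √s ≤ √(k / Real.pi) * Real.exp ((Real.pi * s / k - 1) / 2) := by
    rw [Real.sqrt_le_left (by positivity), mul_pow, Real.sq_sqrt (by positivity), ← Real.exp_nat_mul]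
    have h2 := Real.add_one_le_exp (Real.pi * s / k - 1)
    have h3 : ((2 : ℕ) : ℝ) * ((Real.pi * s / k - 1) / 2) = Real.pi * s / k - 1 := by push_cast; ring
    rw [h3]
    calc s = k / Real.pi * (Real.pi * s / k - 1 + 1) := by field_simp; ring
      _ ≤ _ := by gcongr
  calc √s ^ k * Real.exp (-(Real.pi * s / 2))
      ≤ (√(k / Real.pi) * Real.exp ((Real.pi * s / k - 1) / 2)) ^ k *
        Real.exp (-(Real.pi * s / 2)) := by gcongr
    _ = _ := by
        rw [mul_pow, ← Real.exp_nat_mul, mul_assoc, ← Real.exp_add]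
        congr 2
        field_simp; ring

theorem iSup_norm_stftFun_hermite {k : ℕ} (hk : 1 ≤ k) :
    ⨆ z : ℝ × ℝ, ‖stftFun gaussWindow (hermiteSchwartz k) z.1 z.2‖ =
      ‖stftFun gaussWindow (hermiteSchwartz k) √(k / Real.pi) 0‖ := by
  obtain ⟨A, hA, h⟩ := exists_norm_stftFun_hermite_eq k
  have hle : ∀ z : ℝ × ℝ, ‖stftFun gaussWindow (hermiteSchwartz k) z.1 z.2‖ ≤
      ‖stftFun gaussWindow (hermiteSchwartz k) √(k / Real.pi) 0‖ := by
    intro z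
    rw [h, h, Real.sq_sqrt (by positivity), zero_pow two_ne_zero, add_zero]
    exact mul_le_mul_of_nonneg_left (sqrt_pow_mul_exp_le hk _) hA.le
  refine le_antisymm (ciSup_le hle) ?_
  exact le_ciSup (f := fun z : ℝ × ℝ => ‖stftFun gaussWindow (hermiteSchwartz k) z.1 z.2‖)
    ⟨_, Set.forall_mem_range.mpr hle⟩ (√(k / Real.pi), 0)

theorem minimaxHeight_pos {l : ℕ} (hl : 1 ≤ l) : 0 < minimaxHeight l := by
  have hne : ((fun k : ℕ => ⨆ z : ℝ × ℝ, ‖stftFun gaussWindow (hermiteSchwartz k) z.1 z.2‖) ''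
    Set.Icc 1 l).Nonempty := (Set.nonempty_Icc.mpr hl).image _
  obtain ⟨k, hk, h⟩ := hne.csInf_mem ((Set.finite_Icc 1 l).image _)
  rw [minimaxHeight, ← h]
  simp only
  rw [iSup_norm_stftFun_hermite hk.1]
  obtain ⟨A, hA, h⟩ := exists_norm_stftFun_hermite_eq k
  have : (0 : ℝ) < k := by exact_mod_cast hk.1
  rw [h]
  positivity

theorem minimaxHeight_le {k l : ℕ} (hk : 1 ≤ k) (hkl : k ≤ l) :
    minimaxHeight l ≤ ‖stftFun gaussWindow (hermiteSchwartz k) √(k / Real.pi) 0‖ := by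
  rw [← iSup_norm_stftFun_hermite hk]
  exact csInf_le ((Set.finite_Icc 1 l).image _).bddBelow ⟨k, ⟨hk, hkl⟩, rfl⟩

theorem norm_stft_toTemperedDistribution_hermite (k : ℕ) (u v : ℝ) :
    ‖stft gaussWindow (SchwartzMap.toTemperedDistributionCLM ℝ ℂ volume (hermiteSchwartz k)) u v‖ =
      ‖stftFun gaussWindow (hermiteSchwartz k) u v‖ := by
  have h := SchwartzMap.toTemperedDistributionCLM_apply_apply volume (hermiteSchwartz k)
    (tfShift u v gaussWindow)
  rw [stft]
  refine (congrArg norm h).trans ?_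
  rw [stftFun, ← RCLike.norm_conj,
    ← integral_conj]
  congr 2; funext t
  rw [smul_eq_mul, map_mul, mul_comm, hermiteSchwartz, schwartzOfGauss_apply, Complex.conj_ofReal]

/-! ### Measurability of the level set test -/

theorem measurableSet_exists_le_of_isCompact {Ω X : Type*} [MeasurableSpace Ω] [TopologicalSpace X]
    [SecondCountableTopology X] {K : Set X} (hK : IsCompact K) {W : Ω → X → ℝ}
    (hc : ∀ a, Continuous (W a)) (hm : ∀ x, Measurable fun a => W a x) (θ : ℝ) :
    MeasurableSet {a | ∃ x ∈ K, θ ≤ W a x} := by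
  obtain ⟨D, hDc, hDd⟩ := TopologicalSpace.exists_countable_dense K
  have heq : {a | ∃ x ∈ K, θ ≤ W a x} =
      ⋂ n : ℕ, ⋃ x ∈ D, {a | θ - 1 / ((n : ℝ) + 1) < W a (x : X)} := by
    ext a
    simp only [Set.mem_iInter, Set.mem_iUnion, exists_prop]
    constructor
    · rintro ⟨x, hx, h⟩ n
      have hopen : IsOpen {y : K | θ - 1 / ((n : ℝ) + 1) < W a (y : X)} :=
        isOpen_lt continuous_const ((hc a).comp continuous_subtype_val)
      have hpos : 0 < 1 / ((n : ℝ) + 1) := by positivity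
      obtain ⟨y, hy, hyD⟩ := hDd.inter_open_nonempty _ hopen
        ⟨⟨x, hx⟩, show θ - 1 / ((n : ℝ) + 1) < W a x by linarith⟩
      exact ⟨y, hyD, hy⟩
    · intro h
      obtain ⟨y, -, -⟩ := h 0
      obtain ⟨x, hx, hmax⟩ := hK.exists_isMaxOn ⟨y, y.2⟩ (hc a).continuousOn
      refine ⟨x, hx, ?_⟩
      by_contra! hlt
      obtain ⟨n, hn⟩ := exists_nat_one_div_lt (sub_pos.mpr hlt)
      obtain ⟨z, -, hz⟩ := h n
      have h1 : W a z ≤ W a x := hmax z.2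
      have h2 : θ - 1 / ((n : ℝ) + 1) < W a z := hz
      linarith
  rw [heq]
  exact MeasurableSet.iInter fun n => MeasurableSet.biUnion hDc fun x _ =>
    measurableSet_lt measurable_const (hm x)

theorem isCompact_square (L : ℝ) : IsCompact {z : ℝ × ℝ | max |z.1| |z.2| ≤ L} := by
  have : {z : ℝ × ℝ | max |z.1| |z.2| ≤ L} = Metric.closedBall 0 L := by
    ext z
    simp [Prod.norm_def]
  rw [this]
  exact isCompact_closedBall _ _

theorem measurable_testValue_levelSet {Ω : Type*} [MeasurableSpace Ω] {y : Ω → 𝓢'(ℝ, ℂ)}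
    (hy : ∀ φ, Measurable fun a => y a φ) (L θ : ℝ) :
    Measurable fun a => testValue (levelSet L θ (y a)) := by
  classical
  unfold testValue
  refine Measurable.ite ?_ measurable_const measurable_const
  exact measurableSet_exists_le_of_isCompact (isCompact_square L)
    (W := fun a z => ‖stft gaussWindow (y a) z.1 z.2‖) (fun a => continuous_norm_stft (y a))
    (fun z => (hy _).norm) θ

theorem testValue_eq_one_iff (S : Set (ℝ × ℝ)) : testValue S = 1 ↔ S.Nonempty := by
  unfold testValue; split_ifs with h <;> simp [h]

theorem testValue_eq_zero_iff (S : Set (ℝ × ℝ)) : testValue S = 0 ↔ ¬S.Nonempty := by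
  unfold testValue; split_ifs with h <;> simp [h]

/-! ### Error bounds -/

theorem isNoiseBound_one : IsNoiseBound 1 := by
  intro μ hμ σ hσ hσ' L hL τ hτ
  have := hμ.isProbabilityMeasure
  have h := hμ.measureReal_exceed_le hσ hσ' hL hτ
  rw [mul_one]
  set B := {ξ : 𝓢'(ℝ, ℂ) | ∃ u v : ℝ, max |u| |v| ≤ L ∧ √2 * (14 + τ) * √(Real.log L) ≤
      ‖stft gaussWindow (noiseObs σ ξ) u v‖} with hB
  set G := {ξ : 𝓢'(ℝ, ℂ) | ∀ u v : ℝ, max |u| |v| ≤ L →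
    ‖stft gaussWindow (noiseObs σ ξ) u v‖ ≤ √2 * (14 + τ) * √(Real.log L)} with hG
  have hcover : (Set.univ : Set 𝓢'(ℝ, ℂ)) ⊆ G ∪ B := by
    intro ξ _
    by_contra! hn
    rw [Set.mem_union, not_or] at hn
    refine hn.1 fun u v huv => ?_
    by_contra! hlt
    exact hn.2 ⟨u, v, huv, hlt.le⟩
  have h1 : 1 ≤ μ.real G + μ.real B := by
    calc (1 : ℝ) = μ.real Set.univ := by simp
      _ ≤ μ.real (G ∪ B) := measureReal_mono hcover
      _ ≤ _ := measureReal_union_le _ _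
  linarith

theorem baseLevel_pos {L : ℝ} (hL : Real.pi ≤ L) (δ : ℝ) : 0 < baseLevel 1 L δ := by
  have : 0 < Real.log L := Real.log_pos (by linarith [Real.pi_gt_three])
  unfold baseLevel
  positivity

/-- With probability at least `1 - δ` the noise stays below `√2` times the base level. -/
theorem IsWhiteNoise.measureReal_exceed_baseLevel_le {μ : Measure 𝓢'(ℝ, ℂ)} (hμ : IsWhiteNoise μ)
    {σ L δ : ℝ} (hσ : 0 < σ) (hσ' : σ ≤ √Real.pi) (hL : Real.pi ≤ L) (hδ : 0 < δ) :
    μ.real {ξ | ∃ u v : ℝ, max |u| |v| ≤ L ∧ √2 * baseLevel 1 L δ ≤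
      ‖stft gaussWindow (noiseObs σ ξ) u v‖} ≤ δ := by
  have := hμ.isProbabilityMeasure
  rcases le_or_gt 1 δ with h1 | h1
  · exact measureReal_le_one.trans h1
  have hlog : 0 < Real.log L := Real.log_pos (by linarith [Real.pi_gt_three])
  have hlogδ : 0 < Real.log (4 / δ) := Real.log_pos (by rw [lt_div_iff₀ hδ]; linarith)
  set τ := √(2 * Real.pi * Real.log (4 / δ)) / √(Real.log L) with hτ
  have hτ0 : 0 < τ := by positivity
  have h := hμ.measureReal_exceed_le hσ hσ' hL hτ0
  have e1 : √2 * (14 + τ) * √(Real.log L) = √2 * baseLevel 1 L δ := by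
    rw [baseLevel, hτ]
    have : √(Real.log L) ≠ 0 := (Real.sqrt_pos.mpr hlog).ne'
    field_simp
  have e2 : τ ^ 2 / (2 * Real.pi) * Real.log L = Real.log (4 / δ) := by
    rw [hτ, div_pow, Real.sq_sqrt (by positivity), Real.sq_sqrt hlog.le]
    field_simp
  rw [e1, e2, Real.exp_neg, Real.exp_log (by positivity)] at h
  refine h.trans (le_of_eq ?_)
  field_simp

theorem stft_signalObs (lam σ : ℝ) (k : ℕ) (ξ : 𝓢'(ℝ, ℂ)) (u v : ℝ) :
    stft gaussWindow (signalObs lam σ k ξ) u v = lam * stft gaussWindow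
      (SchwartzMap.toTemperedDistributionCLM ℝ ℂ volume (hermiteSchwartz k)) u v +
      stft gaussWindow (noiseObs σ ξ) u v := rfl

theorem IsWhiteNoise.detects {μ : Measure 𝓢'(ℝ, ℂ)} (hμ : IsWhiteNoise μ)
    {σ L δ lam : ℝ} {k₀ : ℕ} (hσ : 0 < σ) (hσ' : σ ≤ √Real.pi) (hk₀ : 1 ≤ k₀)
    (hL : max (√((k₀ : ℝ) / Real.pi)) Real.pi ≤ L) (hδ : 0 < δ)
    (hlam : 5 * √2 * (minimaxHeight k₀)⁻¹ * baseLevel 1 L δ ≤ |lam|) :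
    Detects μ σ L (threshold 1 L δ) lam k₀ δ := by
  have := hμ.isProbabilityMeasure
  have hLpi : Real.pi ≤ L := (le_max_right _ _).trans hL
  have hB := baseLevel_pos hLpi δ
  have hexc := hμ.measureReal_exceed_baseLevel_le hσ hσ' hLpi hδ
  have h2B : 0 < √2 * baseLevel 1 L δ := by positivity
  refine ⟨?_, ?_, ?_, ?_⟩
  · exact measurable_testValue_levelSet (fun φ => (measurable_apply φ).const_mul (σ : ℂ)) _ _
  · intro k _ _
    exact measurable_testValue_levelSet
      (fun φ => ((measurable_apply φ).const_mul (σ : ℂ)).const_add _) _ _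
  · refine (measureReal_mono ?_).trans hexc
    intro ξ hξ
    obtain ⟨z, hz, hθ⟩ := (testValue_eq_one_iff _).mp hξ
    refine ⟨z.1, z.2, hz, le_trans ?_ hθ⟩
    rw [threshold, mul_assoc]
    linarith
  · intro k hk hkk
    refine (measureReal_mono ?_).trans hexc
    intro ξ hξ
    have hempty := (testValue_eq_zero_iff _).mp hξ
    have hmem : max |√((k : ℝ) / Real.pi)| |(0 : ℝ)| ≤ L := by
      rw [abs_zero, abs_of_nonneg (Real.sqrt_nonneg _)]
      refine max_le ?_ (Real.pi_pos.le.trans hLpi)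
      refine le_trans ?_ ((le_max_left _ _).trans hL)
      gcongr
    refine ⟨√((k : ℝ) / Real.pi), 0, hmem, ?_⟩
    have hlt : ‖stft gaussWindow (signalObs lam σ k ξ) √((k : ℝ) / Real.pi) 0‖ <
        threshold 1 L δ := by
      by_contra! hge
      exact hempty ⟨(√((k : ℝ) / Real.pi), 0), hmem, hge⟩
    have hM := minimaxHeight_pos hk₀
    have hsig : 5 * (√2 * baseLevel 1 L δ) ≤
        ‖(lam : ℂ) * stft gaussWindow (SchwartzMap.toTemperedDistributionCLM ℝ ℂ volume
          (hermiteSchwartz k)) √((k : ℝ) / Real.pi) 0‖ := by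
      rw [norm_mul, Complex.norm_real, Real.norm_eq_abs, norm_stft_toTemperedDistribution_hermite]
      calc 5 * (√2 * baseLevel 1 L δ) =
            5 * √2 * (minimaxHeight k₀)⁻¹ * baseLevel 1 L δ * minimaxHeight k₀ := by field_simp
        _ ≤ _ := mul_le_mul hlam (minimaxHeight_le hk hkk) hM.le (abs_nonneg _)
    rw [stft_signalObs] at hlt
    have htri := norm_sub_le_norm_add ((lam : ℂ) * stft gaussWindow
      (SchwartzMap.toTemperedDistributionCLM ℝ ℂ volume (hermiteSchwartz k)) √((k : ℝ) / Real.pi) 0)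
      (stft gaussWindow (noiseObs σ ξ) √((k : ℝ) / Real.pi) 0)
    rw [threshold, mul_assoc] at hlt
    linarith


end GaborDetection

open GaborDetection in
theorem theorem3 :
    ∃ K : ℝ, 0 < K ∧ IsNoiseBound K ∧
      ∀ (μ : Measure 𝓢'(ℝ, ℂ)), IsWhiteNoise μ →
      ∀ σ : ℝ, 0 < σ → σ ≤ √Real.pi →
      ∀ k₀ : ℕ, 1 ≤ k₀ →
      ∀ L : ℝ, max (√((k₀ : ℝ) / Real.pi)) Real.pi ≤ L →
      ∀ δ : ℝ, 0 < δ →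
      ∀ lam : ℝ, 5 * √2 * (minimaxHeight k₀)⁻¹ * baseLevel K L δ ≤ |lam| →
        Detects μ σ L (threshold K L δ) lam k₀ δ :=
  ⟨1, one_pos, isNoiseBound_one, fun _ hμ _ hσ hσ' _ hk₀ _ hL _ hδ _ hlam =>
    hμ.detects hσ hσ' hk₀ hL hδ hlam⟩
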